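/- Consider $n\ge 1$ nodes sending to one base station. In each handshake phase of duration $T_0$, node $i$ sends an RTS packet (of actual duration $\tilde T_0$, $0<\tilde T_0<T_0$) with probability $p_i\in[0,1]$, independently of the others, with power $P_T>0$ over independent Rayleigh fading channels (the power gains $|h_i|^2$ are exponential with mean one) with noise power $N_0>0$. With $B_i\in\{0,1\}$ the indicator that node $i$ sends, node $i$ is granted the channel, for a data period $T_i>0$, if $\frac{B_i|h_i|^2P_T}{N_0+\sum_{j\ne i}B_j|h_j|^2P_T}>b$, where $b>1$ is the capture ratio; let $G_i=G_i(\mathbf p)$ be the probability of this event. Let $P^s_i\in(0,1]$ be the average frame success rate of node $i$. The average throughput and the normalized average power consumption of node $i$ are $$r_i(\mathbf p)=\frac{P^s_iG_iT_i}{T_0+\sum_jG_jT_j},\qquad S_i(\mathbf p)=\frac{p_i\tilde T_0+G_iT_i}{T_0+\sum_jG_jT_j}.$$ For throughput demands $\rho_1,\dots,\rho_n\ge 0$, a vector $\mathbf p\in[0,1]^n$ is a Nash equilibrium if, for every $i$, $r_i(\mathbf p)\ge\rho_i$ and $p_i$ minimizes $S_i(\tilde p_i,\mathbf p_{-i})$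 among all $\tilde p_i\in[0,1]$ with $r_i(\tilde p_i,\mathbf p_{-i})\ge\rho_i$. The demands are feasible if they have a Nash equilibrium; a Nash equilibrium with $\sum_ip_i\le\frac{b+1}{b}$ is called better. **Theorem.** Assume $b>2$, and that all nodes use the same data period $T_i=MT_0$ and the same channel code (so that all $P^s_i$ are equal). Put $M'=Me^{-bN_0/P_T}$, $\beta=\tilde T_0/T_0$, $\Gamma(n)=\frac{b+1}{b}\left(1-\frac1n\right)^{n-1}$ and, for $n\ge 2$, $$\Psi_{b,n}=\frac{(n-1)(1+b)^2-nb}{b(1+b)(n-1)}\left[\frac{bn+n-b-2}{(1+b)(n-1)}\right]^{n-2}.$$ Then any feasible demands have exactly one better Nash equilibrium $\mathbf p$, and at it: 1. if $n=1$, then $S_1(p_1)\le\frac{M'+\beta}{M'+1}$; 2. if $n>1$, then $$\sum_iS_i(\mathbf p)\le\begin{cases}\dfrac{M'+\beta}{M'+1}&\text{if }\beta\le\dfrac{M'b(1-\Psi_{b,n})}{1+M'+M'b(1-\Psi_{b,n})},\\[2ex]\dfrac{M'\Psi_{b,n}+\beta\frac{b+1}{b}}{M'\Psi_{b,n}+1}&\text{if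 }\dfrac{M'b(1-\Psi_{b,n})}{1+M'+M'b(1-\Psi_{b,n})}\le\beta\le\dfrac{b}{b+1},\\[2ex]\dfrac{M'\Gamma(n)+\beta\frac{b+1}{b}}{M'\Gamma(n)+1}&\text{if }\beta\ge\dfrac{b}{b+1}.\end{cases}$$ Moreover, the bounds are tight: the values $\frac{M'+\beta}{M'+1}$ and, for $n>1$, $\frac{M'\Psi_{b,n}+\beta\frac{b+1}{b}}{M'\Psi_{b,n}+1}$ and $\frac{M'\Gamma(n)+\beta\frac{b+1}{b}}{M'\Gamma(n)+1}$ are equal to $\sum_iS_i(\mathbf p)$ at $\mathbf p=(1,0,\dots,0)$, at $\mathbf p=\left(1,\frac1{(n-1)b},\dots,\frac1{(n-1)b}\right)$ and at $\mathbf p=\left(\frac{b+1}{nb},\dots,\frac{b+1}{nb}\right)$ respectively, as well as at the permutations of these points, and each of these points is the better Nash equilibrium of some feasible demands. -/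

import Mathlib

open MeasureTheory ProbabilityTheory

noncomputable section

/-- A network of `n` saturated nodes sending to one base station over a slotted Rayleigh fading
channel by CSMA with RTS/CTS handshakes. Durations are measured in slots. -/
structure CSMANetwork (n : ℕ) where
  /-- the capture ratio `b` -/
  captureRatio : ℝ
  /-- the power `N₀` of the additive noise at the base station -/
  noise : ℝ
  /-- the transmission power `P_T`, common to all nodes -/
  power : ℝ
  /-- the duration `T₀` of one RTS/CTS handshake -/
  handshakeTime : ℝ
  /-- the actual duration of an RTS packet -/
  rtsTime : ℝ
  /-- the data transmission period `T i` of node `i` -/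
  dataTime : Fin n → ℝ
  /-- the average frame success rate of node `i` with its channel code and its data period -/
  successRate : Fin n → ℝ
  one_lt_captureRatio : 1 < captureRatio
  noise_pos : 0 < noise
  power_pos : 0 < power
  rtsTime_pos : 0 < rtsTime
  rtsTime_lt : rtsTime < handshakeTime
  dataTime_pos : ∀ i, 0 < dataTime i
  successRate_pos : ∀ i, 0 < successRate i
  successRate_le_one : ∀ i, successRate i ≤ 1

namespace CSMANetwork

/-- The law of one handshake phase when node `i` requests with probability `p i`. The outcome `ω i`
of node `i` is the pair of its request indicator `B i` (Bernoulli with parameter `p i`) and its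
channel power gain `|h i| ^ 2` (exponential with mean one); all these variables are independent. -/
def handshakeLaw {n : ℕ} (p : Fin n → unitInterval) : Measure (Fin n → ℝ × ℝ) :=
  Measure.pi fun i => (bernoulliMeasure (1 : ℝ) (0 : ℝ) (p i)).prod (expMeasure 1)

variable {n : ℕ} (N : CSMANetwork n)

/-- The signal-to-interference-plus-noise ratio of the RTS packet of node `i`. -/
def sinr (i : Fin n) (ω : Fin n → ℝ × ℝ) : ℝ :=
  (ω i).1 * (ω i).2 * N.power /
    (N.noise + ∑ j ∈ Finset.univ.erase i, (ω j).1 * (ω j).2 * N.power)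

/-- `G i`: the probability that, in one handshake phase, the base station grants the channel to
node `i`, i.e. that the SINR of the RTS packet of node `i` exceeds the capture ratio. -/
def grantProb (p : Fin n → unitInterval) (i : Fin n) : ℝ :=
  (handshakeLaw p).real {ω | N.captureRatio < N.sinr i ω}

/-- The mean duration `T₀ + ∑ j, G j * T j` of a handshake phase together with the data
transmission (if any) that follows it. -/
def cycleTime (p : Fin n → unitInterval) : ℝ :=
  N.handshakeTime + ∑ j, N.grantProb p j * N.dataTime j

/-- The average throughput `r i` of node `i`: successfully received data packets per slot. -/
def throughput (p : Fin n → unitInterval) (i : Fin n) : ℝ :=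
  N.successRate i * N.grantProb p i * N.dataTime i / N.cycleTime p

/-- The normalized average power consumption `S i` of node `i`: the fraction of time in which it
transmits RTS or data packets. -/
def avgPower (p : Fin n → unitInterval) (i : Fin n) : ℝ :=
  ((p i : ℝ) * N.rtsTime + N.grantProb p i * N.dataTime i) / N.cycleTime p

/-- The total average power consumption `∑ i, S i`. -/
def totalPower (p : Fin n → unitInterval) : ℝ :=
  ∑ i, N.avgPower p i

/-- The utility of node `i`. -/
def utility (p : Fin n → unitInterval) (i : Fin n) : ℝ :=
  1 - N.avgPower p i

/-- `p` is a (constrained) Nash equilibrium for the throughput demands `ρ`: every node meets its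
demand, and no unilateral deviation that still meets the demand has a larger utility. -/
def IsNash (ρ : Fin n → ℝ) (p : Fin n → unitInterval) : Prop :=
  ∀ i, ρ i ≤ N.throughput p i ∧
    ∀ x : unitInterval, ρ i ≤ N.throughput (Function.update p i x) i →
      N.utility (Function.update p i x) i ≤ N.utility p i

/-- The feasible throughput region: the (nonnegative) demands that have a Nash equilibrium. -/
def feasibleRegion : Set (Fin n → ℝ) :=
  {ρ | (∀ i, 0 ≤ ρ i) ∧ ∃ p, N.IsNash ρ p}

/-- `p` is a better Nash equilibrium for `ρ`: one with `∑ i, p i ≤ (b + 1) / b`. -/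
def IsBetterNash (ρ : Fin n → ℝ) (p : Fin n → unitInterval) : Prop :=
  N.IsNash ρ p ∧ ∑ i, (p i : ℝ) ≤ (N.captureRatio + 1) / N.captureRatio

/-- The RTS fraction `β`. -/
def rtsFraction : ℝ := N.rtsTime / N.handshakeTime

end CSMANetwork

/-- `Ψ_{b,n}`, used for `n ≥ 2`. -/
def csmaPsi (b : ℝ) (n : ℕ) : ℝ :=
  (((n : ℝ) - 1) * (1 + b) ^ 2 - n * b) / (b * (1 + b) * ((n : ℝ) - 1)) *
    ((b * n + n - b - 2) / ((1 + b) * ((n : ℝ) - 1))) ^ (n - 2)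

/-- `Γ(n)` for capture ratio `b`, used for `n ≥ 2`. -/
def csmaGamma (b : ℝ) (n : ℕ) : ℝ :=
  (b + 1) / b * (1 - 1 / (n : ℝ)) ^ (n - 1)

end

/-! ### The capture probability over Rayleigh fading -/

/-! Put `a = b / (1 + b)` and `x i = a * p i`. Under Rayleigh fading the tail of an exponential gain
turns noise and interference into a product, and each interferer contributes a Laplace transform, so
`G i` is `exp (-b N₀ / P_T)` times `p i * ∏ j ≠ i, (1 - x j)`. Up to constants this is the
probability that `i` is the only success in independent trials.

The throughput and the power of a node both increase strictly with its own request probability, so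
equilibria are exactly the points where all demands are met with equality (`isNash_iff`), and
equilibria of the same demands share their solo probabilities. In terms of the odds `x i / (1 - x
i)` such points lie on one ray, and exactly one of them has `∑ x ≤ 1`, the condition for being
better (`eq_of_soloProb_one_eq`, `exists_soloProb_one_eq_sum_le_one`).

The total power is `(β s + M' g) / (1 + M' g)`, where `s = ∑ p` and `g` is the sum of the solo
probabilities `p i * ∏ j ≠ i, (1 - x j)`. Moving mass between two coordinates at fixed sum changes
`g` by the change of their product times a factor whose sign can be controlled. Hence `g` lies below
the line through `(s, g) = (1, 1)` and `((b + 1) / b, Ψ)` (`soloSum_add_mul_sum_le`) and above the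
ray through `((b + 1) / b, Γ)` (`sum_mul_le_soloSum`). A bound `1 - κ` on the power is affine in
`(s, g)`, so for `β ≤ b / (b + 1)` only the first two points matter, and the threshold on `β`
decides between them; for larger `β` the lower bound on `g` applies. All three points are attained,
and every point is an equilibrium for the throughput it produces. -/

instance : IsProbabilityMeasure (expMeasure 1) := isProbabilityMeasure_expMeasure one_pos

theorem expMeasure_one_real_Ioi {t : ℝ} (ht : 0 ≤ t) :
    (expMeasure 1).real (Set.Ioi t) = Real.exp (-t) := by
  have h := cdf_expMeasure_eq one_pos t
  rw [cdf_eq_real, if_pos ht, one_mul] at h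
  rw [← Set.compl_Iic, probReal_compl_eq_one_sub measurableSet_Iic, h]
  ring

theorem ae_nonneg_expMeasure_one : ∀ᵐ h ∂expMeasure 1, (0 : ℝ) ≤ h := by
  have h := cdf_expMeasure_eq one_pos 0
  rw [cdf_eq_real] at h
  simp only [le_refl, if_true, mul_zero, neg_zero, Real.exp_zero, sub_self] at h
  rw [ae_iff]
  refine measure_mono_null (t := Set.Iic 0) (fun x hx => ?_) ?_
  · simp only [Set.mem_ofPred_eq, not_le] at hx
    exact hx.le
  · exact (measureReal_eq_zero_iff).1 h

/-- The Laplace transform of the exponential law with mean one. -/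
theorem integral_exp_neg_mul_expMeasure_one {b : ℝ} (hb : 0 < b) :
    ∫ h, Real.exp (-(b * h)) ∂expMeasure 1 = 1 / (1 + b) := by
  have hm : expMeasure 1 = volume.withDensity (exponentialPDF 1) := rfl
  have hmeas : Measurable (exponentialPDF 1) := (measurable_exponentialPDFReal 1).ennreal_ofReal
  rw [hm, integral_withDensity_eq_integral_toReal_smul hmeas
    (Filter.Eventually.of_forall fun x => ENNReal.ofReal_lt_top)]
  have : ∀ x : ℝ, (exponentialPDF 1 x).toReal • Real.exp (-(b * x)) =
      (Set.Ici (0 : ℝ)).indicator (fun x => Real.exp (-(1 + b) * x)) x := by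
    intro x
    rw [exponentialPDF_eq]
    by_cases hx : 0 ≤ x
    · rw [if_pos hx, Set.indicator_of_mem (Set.mem_Ici.2 hx),
        ENNReal.toReal_ofReal (by positivity), smul_eq_mul, one_mul, one_mul, ← Real.exp_add]
      ring_nf
    · rw [if_neg hx, Set.indicator_of_notMem (by simpa using hx)]
      simp
  simp_rw [this]
  rw [integral_indicator measurableSet_Ici, integral_Ici_eq_integral_Ioi,
    integral_exp_mul_Ioi (by linarith) 0, mul_zero, Real.exp_zero, neg_div_neg_eq]

/-- The law of the request indicator and the channel gain of one node. -/
noncomputable def nodeLaw (q : unitInterval) : Measure (ℝ × ℝ) :=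
  (bernoulliMeasure (1 : ℝ) (0 : ℝ) q).prod (expMeasure 1)

instance (q : unitInterval) : IsProbabilityMeasure (nodeLaw q) := by
  unfold nodeLaw; infer_instance

theorem ae_nodeLaw_nonneg (q : unitInterval) : ∀ᵐ z ∂nodeLaw q, 0 ≤ z.1 * z.2 := by
  have h1 : ∀ᵐ x ∂bernoulliMeasure (1 : ℝ) (0 : ℝ) q, 0 ≤ x := by
    have hs : {x : ℝ | ¬ 0 ≤ x} = Set.Iio 0 := by ext; simp
    rw [ae_iff, hs]
    exact bernoulliMeasure_apply_of_notMem_of_notMem q measurableSet_Iio (by simp) (by simp)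
  have h2 : ∀ᵐ z ∂nodeLaw q, 0 ≤ z.1 := Measure.quasiMeasurePreserving_fst.ae h1
  have h3 : ∀ᵐ z ∂nodeLaw q, 0 ≤ z.2 :=
    Measure.quasiMeasurePreserving_snd.ae ae_nonneg_expMeasure_one
  filter_upwards [h2, h3] with z hz1 hz2 using mul_nonneg hz1 hz2

/-- The node is silent with probability `1 - q`, which contributes `1`; otherwise it contributes the
Laplace transform `1 / (1 + b)`. -/
theorem integral_exp_neg_mul_nodeLaw {b : ℝ} (hb : 0 < b) (q : unitInterval) :
    ∫ z, Real.exp (-(b * (z.1 * z.2))) ∂nodeLaw q = 1 - b / (1 + b) * q := by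
  have hint : Integrable (fun z : ℝ × ℝ => Real.exp (-(b * (z.1 * z.2)))) (nodeLaw q) := by
    refine Integrable.of_bound (C := 1) ?_ ?_
    · exact (by fun_prop : Measurable _).aestronglyMeasurable
    · filter_upwards [ae_nodeLaw_nonneg q] with z hz
      rw [Real.norm_eq_abs, abs_of_pos (Real.exp_pos _), Real.exp_le_one_iff]
      nlinarith
  rw [nodeLaw, integral_prod _ hint, integral_bernoulliMeasure]
  simp only [one_mul, zero_mul, mul_zero, neg_zero, Real.exp_zero,
    integral_exp_neg_mul_expMeasure_one hb]
  have : (1 + b) ≠ 0 := by linarith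
  simp
  field_simp
  ring

theorem nodeLaw_real_lt_mul {t : ℝ} (ht : 0 ≤ t) (q : unitInterval) :
    (nodeLaw q).real {z | t < z.1 * z.2} = q * Real.exp (-t) := by
  have hs : MeasurableSet {z : ℝ × ℝ | t < z.1 * z.2} :=
    measurableSet_lt measurable_const (by fun_prop)
  have hint : Integrable (({z : ℝ × ℝ | t < z.1 * z.2}).indicator (1 : ℝ × ℝ → ℝ))
      (nodeLaw q) := (integrable_const 1).indicator hs
  rw [← integral_indicator_one hs]
  unfold nodeLaw at hint ⊢
  rw [integral_prod _ hint, integral_bernoulliMeasure]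
  have h1 : ∀ y : ℝ, ({z : ℝ × ℝ | t < z.1 * z.2}).indicator (1 : ℝ × ℝ → ℝ) (1, y) =
      (Set.Ioi t).indicator 1 y := by
    intro y
    simp [Set.indicator_apply]
  have h0 : ∀ y : ℝ, ({z : ℝ × ℝ | t < z.1 * z.2}).indicator (1 : ℝ × ℝ → ℝ) (0, y) = 0 := by
    intro y
    simp [not_lt.2 ht]
  simp only [h1, h0, integral_zero]
  rw [integral_indicator_one measurableSet_Ioi, expMeasure_one_real_Ioi ht]
  simp

theorem ae_pi_nodeLaw_nonneg {m : ℕ} (q : Fin m → unitInterval) :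
    ∀ᵐ y ∂Measure.pi (fun k => nodeLaw (q k)), ∀ k, 0 ≤ (y k).1 * (y k).2 := by
  rw [ae_all_iff]
  intro k
  exact (Measure.quasiMeasurePreserving_eval (fun k => nodeLaw (q k)) k).ae (ae_nodeLaw_nonneg (q k))

/-- The capture probability of a node that requests with probability `q`, against independent
interferers that request with probabilities `r k`. -/
theorem nodeLaw_prod_pi_real_capture {m : ℕ} {b N₀ P : ℝ} (hb : 0 < b) (hN : 0 < N₀) (hP : 0 < P)
    (q : unitInterval) (r : Fin m → unitInterval) :
    ((nodeLaw q).prod (Measure.pi fun k => nodeLaw (r k))).real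
      {z | b < z.1.1 * z.1.2 * P / (N₀ + ∑ k, (z.2 k).1 * (z.2 k).2 * P)} =
    q * Real.exp (-b * (N₀ / P)) * ∏ k, (1 - b / (1 + b) * r k) := by
  have hs : MeasurableSet {z : (ℝ × ℝ) × (Fin m → ℝ × ℝ) |
      b < z.1.1 * z.1.2 * P / (N₀ + ∑ k, (z.2 k).1 * (z.2 k).2 * P)} :=
    measurableSet_lt measurable_const (by fun_prop)
  -- The interferers are integrated last: once they are fixed, capture is a threshold event for the
  -- sender, and its exponential tail factors over the interferers.
  rw [← integral_indicator_one hs, integral_prod_symm _ ((integrable_const 1).indicator hs)]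
  have h1 : ∀ᵐ y ∂Measure.pi (fun k => nodeLaw (r k)),
      (∫ x, ({z : (ℝ × ℝ) × (Fin m → ℝ × ℝ) | b < z.1.1 * z.1.2 * P /
        (N₀ + ∑ k, (z.2 k).1 * (z.2 k).2 * P)}).indicator (1 : (ℝ × ℝ) × (Fin m → ℝ × ℝ) → ℝ) (x, y) ∂nodeLaw q) =
      q * Real.exp (-b * (N₀ / P)) * ∏ k, Real.exp (-(b * ((y k).1 * (y k).2))) := by
    filter_upwards [ae_pi_nodeLaw_nonneg r] with y hy
    have hI : 0 ≤ ∑ k, (y k).1 * (y k).2 * P :=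
      Finset.sum_nonneg fun k _ => mul_nonneg (hy k) hP.le
    have hset : ∀ x : ℝ × ℝ, ({z : (ℝ × ℝ) × (Fin m → ℝ × ℝ) | b < z.1.1 * z.1.2 * P /
        (N₀ + ∑ k, (z.2 k).1 * (z.2 k).2 * P)}).indicator (1 : (ℝ × ℝ) × (Fin m → ℝ × ℝ) → ℝ) (x, y) =
        ({x : ℝ × ℝ | b * (N₀ / P) + ∑ k, b * ((y k).1 * (y k).2) < x.1 * x.2}).indicator 1 x := by
      intro x
      simp only [Set.indicator_apply, Set.mem_ofPred_eq, Pi.one_apply]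
      congr 1
      rw [lt_div_iff₀ (by linarith), ← Finset.mul_sum, ← Finset.sum_mul, eq_iff_iff]
      have : b * (N₀ / P) + b * ∑ k, (y k).1 * (y k).2 =
        b * (N₀ + (∑ k, (y k).1 * (y k).2) * P) / P := by field_simp
      rw [this, div_lt_iff₀ hP]
    simp_rw [hset]
    rw [integral_indicator_one (measurableSet_lt measurable_const (by fun_prop)),
      nodeLaw_real_lt_mul, ← Real.exp_sum, mul_assoc, ← Real.exp_add, Finset.sum_neg_distrib]
    · congr 2; ring
    · have : 0 ≤ ∑ k, b * ((y k).1 * (y k).2) :=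
        Finset.sum_nonneg fun k _ => mul_nonneg hb.le (hy k)
      positivity
  rw [integral_congr_ae h1, integral_const_mul]
  congr 1
  rw [integral_fintype_prod_eq_prod (𝕜 := ℝ)
    (fun (k : Fin m) (z : ℝ × ℝ) => Real.exp (-(b * (z.1 * z.2))))]
  exact Finset.prod_congr rfl fun k _ => integral_exp_neg_mul_nodeLaw hb (r k)

namespace CSMANetwork

theorem grantProb_eq {n : ℕ} (N : CSMANetwork n) (p : Fin n → unitInterval) (i : Fin n) :
    N.grantProb p i = Real.exp (-N.captureRatio * (N.noise / N.power)) *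
      (p i * ∏ j ∈ Finset.univ.erase i,
        (1 - N.captureRatio / (1 + N.captureRatio) * (p j : ℝ))) := by
  have hb : 0 < N.captureRatio := by linarith [N.one_lt_captureRatio]
  obtain _ | m := n
  · exact i.elim0
  have herase : (Finset.univ.erase i : Finset (Fin (m + 1))) =
      Finset.univ.map i.succAboveEmb := by
    ext j
    simp [Fin.exists_succAbove_eq_iff]
  have hmp := measurePreserving_piFinSuccAbove (fun j => nodeLaw (p j)) i
  have hs : MeasurableSet {z : (ℝ × ℝ) × (Fin m → ℝ × ℝ) | N.captureRatio <
      z.1.1 * z.1.2 * N.power / (N.noise + ∑ k, (z.2 k).1 * (z.2 k).2 * N.power)} :=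
    measurableSet_lt measurable_const (by fun_prop)
  have h := nodeLaw_prod_pi_real_capture hb N.noise_pos N.power_pos (p i)
    (fun k => p (i.succAbove k))
  have hpre := hmp.measureReal_preimage hs.nullMeasurableSet
  rw [h] at hpre
  rw [herase, Finset.prod_map, grantProb]
  have hset : {ω | N.captureRatio < N.sinr i ω} =
      (MeasurableEquiv.piFinSuccAbove (fun _ : Fin (m + 1) => ℝ × ℝ) i) ⁻¹'
        {z | N.captureRatio < z.1.1 * z.1.2 * N.power /
          (N.noise + ∑ k, (z.2 k).1 * (z.2 k).2 * N.power)} := by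
    ext ω
    simp only [sinr, herase, Finset.sum_map, Set.mem_ofPred_eq, Set.mem_preimage]
    rfl
  rw [hset]
  -- `handshakeLaw p` is by definition the product of the laws `nodeLaw (p j)`.
  refine hpre.trans ?_
  simp only [Fin.coe_succAboveEmb]
  ring

end CSMANetwork

/-! ### Throughput and power as rational functions, and the Nash condition -/

/-- For `a = 1`, the probability that `i` is the only success in independent trials with success
probabilities `x`. -/
noncomputable def soloProb {n : ℕ} (a : ℝ) (x : Fin n → ℝ) (i : Fin n) : ℝ :=
  x i * ∏ j ∈ Finset.univ.erase i, (1 - a * x j)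

theorem mul_soloProb {n : ℕ} (a : ℝ) (x : Fin n → ℝ) (i : Fin n) :
    a * soloProb a x i = soloProb 1 (fun j => a * x j) i := by
  simp only [soloProb, one_mul]
  ring

theorem soloProb_nonneg {n : ℕ} {a : ℝ} {x : Fin n → ℝ} (hx0 : ∀ i, 0 ≤ x i)
    (hx1 : ∀ i, a * x i ≤ 1) (i : Fin n) : 0 ≤ soloProb a x i :=
  mul_nonneg (hx0 i) (Finset.prod_nonneg fun j _ => by linarith [hx1 j])

theorem soloProb_le {n : ℕ} {a : ℝ} {x : Fin n → ℝ} (ha : 0 ≤ a) (hx0 : ∀ i, 0 ≤ x i)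
    (hx1 : ∀ i, a * x i ≤ 1) (i : Fin n) : soloProb a x i ≤ x i := by
  refine mul_le_of_le_one_right (hx0 i) (Finset.prod_le_one (fun j _ => ?_) fun j _ => ?_)
  · linarith [hx1 j]
  · linarith [mul_nonneg ha (hx0 j)]

theorem soloProb_update_self {n : ℕ} (a : ℝ) (x : Fin n → ℝ) (i : Fin n) (t : ℝ) :
    soloProb a (Function.update x i t) i = t * ∏ j ∈ Finset.univ.erase i, (1 - a * x j) := by
  rw [soloProb, Function.update_self]
  congr 1
  refine Finset.prod_congr rfl fun j hj => ?_
  rw [Function.update_of_ne (Finset.ne_of_mem_erase hj)]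

theorem soloProb_update_of_ne {n : ℕ} (a : ℝ) (x : Fin n → ℝ) {i j : Fin n} (h : j ≠ i) (t : ℝ) :
    soloProb a (Function.update x i t) j =
      (1 - a * t) * (x j * ∏ k ∈ (Finset.univ.erase j).erase i, (1 - a * x k)) := by
  have hi : i ∈ Finset.univ.erase j := by simp [h.symm]
  rw [soloProb, Function.update_of_ne h, ← Finset.mul_prod_erase _ _ hi, Function.update_self]
  rw [Finset.prod_congr rfl fun k hk => by
    rw [Function.update_of_ne (Finset.ne_of_mem_erase hk)]]
  ring

/-- The sum is affine in each single coordinate, so throughput and power of a node are linear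
fractional in its own request probability. -/
theorem sum_soloProb_update {n : ℕ} (a : ℝ) (x : Fin n → ℝ) (i : Fin n) (t : ℝ) :
    ∑ j, soloProb a (Function.update x i t) j =
      t * (∏ j ∈ Finset.univ.erase i, (1 - a * x j)) + (1 - a * t) *
        ∑ j ∈ Finset.univ.erase i, x j * ∏ k ∈ (Finset.univ.erase j).erase i, (1 - a * x k) := by
  rw [← Finset.add_sum_erase _ _ (Finset.mem_univ i), soloProb_update_self, Finset.mul_sum]
  congr 1
  exact Finset.sum_congr rfl fun j hj => soloProb_update_of_ne a x (Finset.ne_of_mem_erase hj) t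

/-- After cross-multiplication the difference is `K * E * (y - x)`; the sign of `D` plays no role.
-/
theorem mul_div_add_mul_lt {x y K E D : ℝ} (hK : 0 < K) (hE : 0 < E) (hxy : x < y)
    (hx : 0 < E + x * D) (hy : 0 < E + y * D) : x * K / (E + x * D) < y * K / (E + y * D) := by
  rw [div_lt_div_iff₀ hx hy]
  nlinarith [mul_pos (mul_pos hK hE) (sub_pos.2 hxy)]

/-- Summing the hypotheses shows that `s / (1 + m * s)` agrees for the two sums; this map is
injective, so the denominators coincide. -/
theorem eq_of_div_one_add_sum_eq {n : ℕ} {m : ℝ} {u v : Fin n → ℝ}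
    (hu : 0 < 1 + m * ∑ i, u i) (hv : 0 < 1 + m * ∑ i, v i)
    (h : ∀ i, u i / (1 + m * ∑ i, u i) = v i / (1 + m * ∑ i, v i)) : u = v := by
  have hs : (∑ i, u i) / (1 + m * ∑ i, u i) = (∑ i, v i) / (1 + m * ∑ i, v i) := by
    rw [Finset.sum_div, Finset.sum_div]
    exact Finset.sum_congr rfl fun i _ => h i
  have hs' : ∑ i, u i = ∑ i, v i := by
    rw [div_eq_div_iff hu.ne' hv.ne'] at hs
    linarith
  ext i
  have := h i
  rw [hs'] at this
  field_simp at this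
  exact this

namespace CSMANetwork

variable {n : ℕ} (N : CSMANetwork n)

/-- The interference loss `b / (1 + b)`. -/
noncomputable def lossFactor : ℝ := N.captureRatio / (1 + N.captureRatio)

theorem lossFactor_pos : 0 < N.lossFactor := by
  have := N.one_lt_captureRatio
  unfold lossFactor
  positivity

theorem lossFactor_lt_one : N.lossFactor < 1 := by
  have := N.one_lt_captureRatio
  rw [lossFactor, div_lt_one (by linarith)]
  linarith

theorem rtsFraction_pos : 0 < N.rtsFraction :=
  div_pos N.rtsTime_pos (N.rtsTime_pos.trans N.rtsTime_lt)

theorem rtsFraction_lt_one : N.rtsFraction < 1 :=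
  (div_lt_one (N.rtsTime_pos.trans N.rtsTime_lt)).2 N.rtsTime_lt

theorem lossFactor_mul_lt_one (x : unitInterval) : N.lossFactor * x < 1 := by
  nlinarith [N.lossFactor_pos, N.lossFactor_lt_one, x.2.1, x.2.2]

section Common

variable {N} {M m : ℝ} (hT : ∀ i, N.dataTime i = M * N.handshakeTime)
  (hm : m = M * Real.exp (-N.captureRatio * (N.noise / N.power)))

include hT hm

theorem grantProb_mul_dataTime (p : Fin n → unitInterval) (i : Fin n) :
    N.grantProb p i * N.dataTime i =
      N.handshakeTime * (m * soloProb N.lossFactor (fun j => (p j : ℝ)) i) := by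
  rw [grantProb_eq, hT, hm, soloProb, lossFactor]
  ring

theorem cycleTime_eq (p : Fin n → unitInterval) :
    N.cycleTime p = N.handshakeTime *
      (1 + m * ∑ i, soloProb N.lossFactor (fun j => (p j : ℝ)) i) := by
  rw [cycleTime, Finset.sum_congr rfl fun i _ => grantProb_mul_dataTime hT hm p i,
    ← Finset.mul_sum, ← Finset.mul_sum]
  ring

theorem throughput_eq (p : Fin n → unitInterval) (i : Fin n) :
    N.throughput p i = N.successRate i * m *
      (soloProb N.lossFactor (fun j => (p j : ℝ)) i /
        (1 + m * ∑ i, soloProb N.lossFactor (fun j => (p j : ℝ)) i)) := by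
  have h0 : 0 < N.handshakeTime := N.rtsTime_pos.trans N.rtsTime_lt
  rw [throughput, mul_assoc, grantProb_mul_dataTime hT hm, cycleTime_eq hT hm,
    mul_left_comm, mul_div_mul_left _ _ h0.ne']
  ring

theorem avgPower_eq (p : Fin n → unitInterval) (i : Fin n) :
    N.avgPower p i =
      (N.rtsFraction * p i + m * soloProb N.lossFactor (fun j => (p j : ℝ)) i) /
        (1 + m * ∑ i, soloProb N.lossFactor (fun j => (p j : ℝ)) i) := by
  have h0 : 0 < N.handshakeTime := N.rtsTime_pos.trans N.rtsTime_lt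
  have h1 : (p i : ℝ) * N.rtsTime = N.handshakeTime * (N.rtsFraction * p i) := by
    rw [rtsFraction]
    field_simp
  rw [avgPower, grantProb_mul_dataTime hT hm, cycleTime_eq hT hm, h1, ← mul_add,
    mul_div_mul_left _ _ h0.ne']

theorem totalPower_eq (p : Fin n → unitInterval) :
    N.totalPower p =
      (N.rtsFraction * ∑ i, (p i : ℝ) +
        m * ∑ i, soloProb N.lossFactor (fun j => (p j : ℝ)) i) /
        (1 + m * ∑ i, soloProb N.lossFactor (fun j => (p j : ℝ)) i) := by
  rw [totalPower, Finset.sum_congr rfl fun i _ => avgPower_eq hT hm p i, ← Finset.sum_div,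
    Finset.sum_add_distrib, Finset.mul_sum, Finset.mul_sum]

omit hT hm in
theorem one_add_mul_sum_soloProb_pos (hm0 : 0 < m) (p : Fin n → unitInterval) :
    0 < 1 + m * ∑ i, soloProb N.lossFactor (fun j => (p j : ℝ)) i := by
  have : 0 ≤ ∑ i, soloProb N.lossFactor (fun j => (p j : ℝ)) i :=
    Finset.sum_nonneg fun i _ => soloProb_nonneg (fun j => (p j).2.1)
      (fun j => (N.lossFactor_mul_lt_one (p j)).le) i
  positivity

omit hT hm in
theorem coe_update (p : Fin n → unitInterval) (i : Fin n) (x : unitInterval) :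
    (fun j => (Function.update p i x j : ℝ)) = Function.update (fun j => (p j : ℝ)) i x := by
  ext j
  by_cases h : j = i
  · subst h; simp
  · simp [h]

/-- The throughput and the power of a node as functions of its own request probability. -/
theorem exists_eq_of_update (hm0 : 0 < m) (p : Fin n → unitInterval) (i : Fin n) :
    ∃ K K' E D : ℝ, 0 < K ∧ 0 < K' ∧ 0 < E ∧
      (∀ x : unitInterval, 0 < E + x * D) ∧
      (∀ x : unitInterval, N.throughput (Function.update p i x) i = x * K / (E + x * D)) ∧
      (∀ x : unitInterval, N.avgPower (Function.update p i x) i = x * K' / (E + x * D)) := by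
  set a := N.lossFactor with ha
  set A := ∏ j ∈ Finset.univ.erase i, (1 - a * (p j : ℝ)) with hA
  set C := ∑ j ∈ Finset.univ.erase i, (p j : ℝ) *
    ∏ k ∈ (Finset.univ.erase j).erase i, (1 - a * (p k : ℝ)) with hC
  have hpos : ∀ j, 0 < 1 - a * (p j : ℝ) := fun j => by linarith [N.lossFactor_mul_lt_one (p j)]
  have hA0 : 0 < A := Finset.prod_pos fun j _ => hpos j
  have hC0 : 0 ≤ C := Finset.sum_nonneg fun j _ =>
    mul_nonneg (p j).2.1 (Finset.prod_nonneg fun k _ => (hpos k).le)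
  have hps := N.successRate_pos i
  have hden : ∀ x : unitInterval,
      1 + m * ∑ j, soloProb a (fun j => (Function.update p i x j : ℝ)) j =
        (1 + m * C) + x * (m * A - m * a * C) := by
    intro x
    rw [coe_update, sum_soloProb_update]
    ring
  refine ⟨N.successRate i * m * A, N.rtsFraction + m * A, 1 + m * C, m * A - m * a * C,
    by positivity, ?_, by positivity, fun x => ?_, fun x => ?_, fun x => ?_⟩
  · have := N.rtsFraction_pos
    positivity
  · rw [← hden]
    exact one_add_mul_sum_soloProb_pos hm0 _
  · rw [throughput_eq hT hm, hden, coe_update, soloProb_update_self]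
    ring
  · rw [avgPower_eq hT hm, hden, coe_update, soloProb_update_self, Function.update_self]
    ring

/-- The Nash equilibria are the points at which every node exactly meets its demand. -/
theorem isNash_iff (hm0 : 0 < m) {ρ : Fin n → ℝ} (hρ : ∀ i, 0 ≤ ρ i) (p : Fin n → unitInterval) :
    N.IsNash ρ p ↔ N.throughput p = ρ := by
  constructor
  · intro h
    ext i
    obtain ⟨K, K', E, D, hK, hK', hE, hpos, hr, hS⟩ := exists_eq_of_update hT hm hm0 p i
    obtain ⟨h1, h2⟩ := h i
    -- A node with excess throughput could lower its request probability until the demand is met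
    -- exactly, and would then use strictly less power.
    refine le_antisymm (not_lt.1 fun hlt => ?_) h1
    have hp : N.throughput p i = (p i : ℝ) * K / (E + p i * D) := by
      rw [← hr, Function.update_eq_self]
    have hSp : N.avgPower p i = (p i : ℝ) * K' / (E + p i * D) := by
      rw [← hS, Function.update_eq_self]
    have hcont : ContinuousOn (fun x : ℝ => x * K / (E + x * D)) (Set.Icc 0 (p i)) := by
      refine ContinuousOn.div (by fun_prop) (by fun_prop) fun x hx => ?_
      exact (hpos ⟨x, hx.1, hx.2.trans (p i).2.2⟩).ne'
    have hmem : ρ i ∈ Set.Icc ((0 : ℝ) * K / (E + 0 * D)) ((p i : ℝ) * K / (E + p i * D)) := by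
      refine ⟨by simpa using hρ i, ?_⟩
      rw [← hp]
      exact h1
    obtain ⟨x, hx, hxρ⟩ := intermediate_value_Icc (p i).2.1 hcont hmem
    let y : unitInterval := ⟨x, hx.1, hx.2.trans (p i).2.2⟩
    have hy : N.throughput (Function.update p i y) i = ρ i := by rw [hr]; exact hxρ
    have hne : x < p i := by
      refine lt_of_le_of_ne hx.2 fun he => ?_
      rw [he] at hxρ
      simp only at hxρ
      rw [← hp] at hxρ
      exact hlt.ne' hxρ
    have := h2 y hy.ge
    simp only [utility] at this
    rw [hS, hSp] at this
    have hlt' := mul_div_add_mul_lt hK' hE hne (hpos y) (hpos (p i))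
    have hyx : (y : ℝ) = x := rfl
    rw [hyx] at this
    linarith
  · rintro rfl i
    obtain ⟨K, K', E, D, hK, hK', hE, hpos, hr, hS⟩ := exists_eq_of_update hT hm hm0 p i
    refine ⟨le_rfl, fun x hx => ?_⟩
    have hp : N.throughput p i = (p i : ℝ) * K / (E + p i * D) := by
      rw [← hr, Function.update_eq_self]
    have hSp : N.avgPower p i = (p i : ℝ) * K' / (E + p i * D) := by
      rw [← hS, Function.update_eq_self]
    rw [hr, hp] at hx
    -- By monotonicity of the throughput, an admissible deviation can only raise the request
    -- probability, and the power rises with it.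
    have hle : (p i : ℝ) ≤ x := not_lt.1 fun hlt =>
      absurd (mul_div_add_mul_lt hK hE hlt (hpos x) (hpos (p i))) (not_lt.2 hx)
    simp only [utility]
    rw [hS, hSp]
    obtain heq | hlt := hle.eq_or_lt
    · rw [heq]
    · linarith [mul_div_add_mul_lt hK' hE hlt (hpos (p i)) (hpos x)]

theorem throughput_nonneg (hm0 : 0 < m) (p : Fin n → unitInterval) (i : Fin n) :
    0 ≤ N.throughput p i := by
  rw [throughput_eq hT hm]
  have h1 := N.successRate_pos i
  have h2 := one_add_mul_sum_soloProb_pos (N := N) hm0 p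
  have h3 := soloProb_nonneg (a := N.lossFactor) (fun j => (p j).2.1)
      (fun j => (N.lossFactor_mul_lt_one (p j)).le) i
  positivity

theorem throughput_eq_iff (hm0 : 0 < m) (p q : Fin n → unitInterval) :
    N.throughput p = N.throughput q ↔
      soloProb N.lossFactor (fun j => (p j : ℝ)) = soloProb N.lossFactor (fun j => (q j : ℝ)) := by
  constructor
  · intro h
    refine eq_of_div_one_add_sum_eq (one_add_mul_sum_soloProb_pos hm0 p)
      (one_add_mul_sum_soloProb_pos hm0 q) fun i => ?_
    have hi := congrFun h i
    rw [throughput_eq hT hm, throughput_eq hT hm] at hi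
    exact mul_left_cancel₀ (mul_pos (N.successRate_pos i) hm0).ne' hi
  · intro h
    ext i
    rw [throughput_eq hT hm, throughput_eq hT hm, h]

end Common

end CSMANetwork

/-! ### Points with the same grant probabilities -/

section Odds

variable {n : ℕ}

/-- In odds coordinates the normalisation is common to all nodes, so equal solo probabilities force
proportional odds. -/
theorem soloProb_one_div_one_add {z : Fin n → ℝ} (hz : ∀ i, 0 ≤ z i) (i : Fin n) :
    soloProb 1 (fun j => z j / (1 + z j)) i = z i / ∏ j, (1 + z j) := by
  have h : ∀ j, 1 - 1 * (z j / (1 + z j)) = (1 + z j)⁻¹ := fun j => by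
    have : (1 + z j) ≠ 0 := by linarith [hz j]
    field_simp
    ring
  have h0 : ∏ j ∈ Finset.univ.erase i, (1 + z j) ≠ 0 :=
    Finset.prod_ne_zero_iff.2 fun j _ => by linarith [hz j]
  have h1 : 1 + z i ≠ 0 := by linarith [hz i]
  rw [soloProb, Finset.prod_congr rfl fun j _ => h j, Finset.prod_inv_distrib,
    ← Finset.mul_prod_erase _ _ (Finset.mem_univ i)]
  field_simp

theorem one_sub_sum_le_prod_one_sub {ι : Type*} (s : Finset ι) {z : ι → ℝ}
    (h0 : ∀ i ∈ s, 0 ≤ z i) (h1 : ∀ i ∈ s, z i ≤ 1) :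
    1 - ∑ i ∈ s, z i ≤ ∏ i ∈ s, (1 - z i) := by
  classical
  induction s using Finset.induction_on with
  | empty => simp
  | insert i s hi ih =>
    rw [Finset.sum_insert hi, Finset.prod_insert hi]
    have ih' := ih (fun j hj => h0 j (Finset.mem_insert_of_mem hj))
      fun j hj => h1 j (Finset.mem_insert_of_mem hj)
    have hs : 0 ≤ ∑ j ∈ s, z j :=
      Finset.sum_nonneg fun j hj => h0 j (Finset.mem_insert_of_mem hj)
    have hi0 := h0 i (Finset.mem_insert_self i s)
    have hi1 := h1 i (Finset.mem_insert_self i s)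
    nlinarith [mul_le_mul_of_nonneg_left ih' (sub_nonneg.2 hi1), mul_nonneg hi0 hs]

theorem one_add_sum_le_prod_one_add {ι : Type*} (s : Finset ι) {z : ι → ℝ}
    (h0 : ∀ i ∈ s, 0 ≤ z i) : 1 + ∑ i ∈ s, z i ≤ ∏ i ∈ s, (1 + z i) := by
  classical
  induction s using Finset.induction_on with
  | empty => simp
  | insert i s hi ih =>
    rw [Finset.sum_insert hi, Finset.prod_insert hi]
    have ih' := ih fun j hj => h0 j (Finset.mem_insert_of_mem hj)
    have hs : 0 ≤ ∑ j ∈ s, z j :=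
      Finset.sum_nonneg fun j hj => h0 j (Finset.mem_insert_of_mem hj)
    have hi0 := h0 i (Finset.mem_insert_self i s)
    nlinarith [mul_le_mul_of_nonneg_left ih' hi0, mul_nonneg hi0 hs]

/-- In the region `∑ i, x i ≤ 1`, contracting the odds changes their product normalisation
strictly more than linearly. -/
theorem lt_prod_one_sub_of_sum_le_one {x : Fin n → ℝ} (h0 : ∀ i, 0 ≤ x i) (h1 : ∀ i, x i < 1)
    (hs : ∑ i, x i ≤ 1) {r : ℝ} (hr0 : 0 < r) (hr1 : r < 1) :
    r < ∏ i, (1 - (1 - r) * x i) := by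
  have hz0 : ∀ i, 0 ≤ (1 - r) * x i := fun i => mul_nonneg (by linarith) (h0 i)
  have hz1 : ∀ i, (1 - r) * x i ≤ 1 := fun i => by nlinarith [h0 i, h1 i]
  by_cases hx : ∃ i, 0 < x i
  · obtain ⟨i, hi⟩ := hx
    have hsum := Finset.add_sum_erase Finset.univ x (Finset.mem_univ i)
    set τ := ∑ j ∈ Finset.univ.erase i, x j
    have hτ : 0 ≤ τ := Finset.sum_nonneg fun j _ => h0 j
    have hw := one_sub_sum_le_prod_one_sub (Finset.univ.erase i) (fun j _ => hz0 j)
      fun j _ => hz1 j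
    rw [← Finset.mul_sum] at hw
    rw [← Finset.mul_prod_erase _ _ (Finset.mem_univ i)]
    refine lt_of_lt_of_le ?_ (mul_le_mul_of_nonneg_left hw (by linarith [hz1 i]))
    have hr : 0 < 1 - r := by linarith
    -- This is the excess of the two-factor product over `r`. It is positive because of `x i < 1` if
    -- `τ = 0`, and because of the cross term otherwise.
    have h2 : 0 < (1 - r) * ((1 - x i - τ) + (1 - r) * x i * τ) := by
      refine mul_pos hr ?_
      obtain hτ' | hτ' := hτ.eq_or_lt
      · rw [← hτ']
        linarith [h1 i]
      · have : 0 < (1 - r) * x i * τ := by positivity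
        linarith
    change r < (1 - (1 - r) * x i) * (1 - (1 - r) * τ)
    linarith
  · push Not at hx
    have : ∀ i, x i = 0 := fun i => le_antisymm (hx i) (h0 i)
    simpa [this] using hr1

/-- The odds satisfy `z = r • w` with `r ≤ 1` the ratio of the normalisations. Expanding that ratio
gives `r = ∏ (1 - (1 - r) * x i)` with `x i = w i / (1 + w i)`, which is impossible for `r < 1`.
Only the point with the larger normalisation has to satisfy the sum condition. -/
theorem eq_of_odds_div_eq {z w : Fin n → ℝ} (hz : ∀ i, 0 ≤ z i) (hw : ∀ i, 0 ≤ w i)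
    (hws : ∑ i, w i / (1 + w i) ≤ 1) (hle : ∏ i, (1 + z i) ≤ ∏ i, (1 + w i))
    (h : ∀ i, z i / ∏ j, (1 + z j) = w i / ∏ j, (1 + w j)) : z = w := by
  have hZ : 0 < ∏ i, (1 + z i) := Finset.prod_pos fun i _ => by linarith [hz i]
  have hW : 0 < ∏ i, (1 + w i) := Finset.prod_pos fun i _ => by linarith [hw i]
  obtain ⟨r, hr⟩ : ∃ r, r = (∏ i, (1 + z i)) / ∏ i, (1 + w i) := ⟨_, rfl⟩
  have hr0 : 0 < r := hr ▸ div_pos hZ hW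
  have hzw : ∀ i, z i = r * w i := fun i => by
    have := h i
    rw [div_eq_div_iff hZ.ne' hW.ne'] at this
    rw [hr]
    field_simp
    linarith
  have hprod : ∏ i, (1 + z i) = (∏ i, (1 + w i)) * ∏ i, (1 - (1 - r) * (w i / (1 + w i))) := by
    rw [← Finset.prod_mul_distrib]
    refine Finset.prod_congr rfl fun i _ => ?_
    have : (1 + w i) ≠ 0 := by linarith [hw i]
    rw [hzw]
    field_simp
    ring
  have hreq : r = ∏ i, (1 - (1 - r) * (w i / (1 + w i))) := by
    conv_lhs => rw [hr, hprod, mul_div_cancel_left₀ _ hW.ne']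
  obtain hr1 | hr1 := (show r ≤ 1 from hr ▸ (div_le_one hW).2 hle).lt_or_eq
  · have := lt_prod_one_sub_of_sum_le_one (x := fun i => w i / (1 + w i))
      (fun i => div_nonneg (hw i) (by linarith [hw i]))
      (fun i => (div_lt_one (by linarith [hw i])).2 (by linarith)) hws hr0 hr1
    exact absurd hreq this.ne
  · ext i
    rw [hzw, hr1, one_mul]

theorem eq_odds_div_one_add {x : Fin n → ℝ} (h1 : ∀ i, x i < 1) :
    x = fun i => x i / (1 - x i) / (1 + x i / (1 - x i)) := by
  ext i
  have : 1 - x i ≠ 0 := by linarith [h1 i]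
  field_simp
  ring

theorem eq_of_soloProb_one_eq {x y : Fin n → ℝ} (hx0 : ∀ i, 0 ≤ x i) (hx1 : ∀ i, x i < 1)
    (hxs : ∑ i, x i ≤ 1) (hy0 : ∀ i, 0 ≤ y i) (hy1 : ∀ i, y i < 1) (hys : ∑ i, y i ≤ 1)
    (h : soloProb 1 x = soloProb 1 y) : x = y := by
  have hz : ∀ i, 0 ≤ x i / (1 - x i) := fun i => div_nonneg (hx0 i) (by linarith [hx1 i])
  have hw : ∀ i, 0 ≤ y i / (1 - y i) := fun i => div_nonneg (hy0 i) (by linarith [hy1 i])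
  have hx := eq_odds_div_one_add hx1
  have hy := eq_odds_div_one_add hy1
  set z := fun i => x i / (1 - x i)
  set w := fun i => y i / (1 - y i)
  have key : ∀ i, z i / ∏ j, (1 + z j) = w i / ∏ j, (1 + w j) := fun i => by
    rw [← soloProb_one_div_one_add hz, ← soloProb_one_div_one_add hw]
    change x = fun i => z i / (1 + z i) at hx
    change y = fun i => w i / (1 + w i) at hy
    rw [← hx, ← hy, h]
  have hzw : z = w := by
    obtain hle | hle := le_total (∏ i, (1 + z i)) (∏ i, (1 + w i))
    · refine eq_of_odds_div_eq hz hw ?_ hle key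
      rwa [hy] at hys
    · refine (eq_of_odds_div_eq hw hz ?_ hle fun i => (key i).symm).symm
      rwa [hx] at hxs
  rw [hx, hy]
  ext i
  change z i / (1 + z i) = w i / (1 + w i)
  rw [hzw]

/-- The odds can be contracted to reach the region `∑ i, x i ≤ 1` without changing the
probabilities of being the only success. -/
theorem exists_soloProb_one_eq_sum_le_one {x : Fin n → ℝ} (hx0 : ∀ i, 0 ≤ x i)
    (hx1 : ∀ i, x i < 1) :
    ∃ y : Fin n → ℝ, (∀ i, 0 ≤ y i) ∧ (∀ i, y i ≤ x i) ∧ ∑ i, y i ≤ 1 ∧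
      soloProb 1 y = soloProb 1 x := by
  by_cases hs : ∑ i, x i ≤ 1
  · exact ⟨x, hx0, fun i => le_rfl, hs, rfl⟩
  push Not at hs
  have ho : ∀ i, 0 ≤ x i / (1 - x i) := fun i => div_nonneg (hx0 i) (by linarith [hx1 i])
  have hx := eq_odds_div_one_add hx1
  set o := fun i => x i / (1 - x i) with ho_def
  change x = fun i => o i / (1 + o i) at hx
  replace ho : ∀ i, 0 ≤ o i := ho
  have hpos : ∀ s : ℝ, 0 ≤ s → ∀ i, 0 < 1 + s * o i := fun s hs i => by
    have := mul_nonneg hs (ho i)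
    linarith
  have hmono : ∀ s t : ℝ, 0 ≤ s → s ≤ t → ∀ i, s * o i / (1 + s * o i) ≤ t * o i / (1 + t * o i) := by
    intro s t hs hst i
    rw [div_le_div_iff₀ (hpos s hs i) (hpos t (hs.trans hst) i)]
    nlinarith [mul_le_mul_of_nonneg_right hst (ho i)]
  have hcont : ContinuousOn (fun s : ℝ => ∑ i, s * o i / (1 + s * o i)) (Set.Icc 0 1) :=
    continuousOn_finsetSum _ fun i _ => ContinuousOn.div (by fun_prop) (by fun_prop)
      fun s hs => (hpos s hs.1 i).ne'
  have h01 : ∑ i, (1 : ℝ) * o i / (1 + 1 * o i) = ∑ i, x i := by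
    conv_rhs => rw [hx]
    simp
  -- `s` is the contraction of the odds that brings the sum of the probabilities to exactly `1`.
  obtain ⟨s, ⟨hs0, hs1⟩, hsum⟩ := intermediate_value_Icc zero_le_one hcont
    (show (1 : ℝ) ∈ Set.Icc (∑ i, (0 : ℝ) * o i / (1 + 0 * o i))
      (∑ i, (1 : ℝ) * o i / (1 + 1 * o i)) from ⟨by simp, by rw [h01]; exact hs.le⟩)
  simp only at hsum
  have hspos : 0 < s := by
    refine lt_of_le_of_ne hs0 fun h => ?_
    rw [← h] at hsum
    simp at hsum
  -- Undoing the contraction multiplies the normalisation by `∏ (1 + (1 / s - 1) * y i)` with `∑ y =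
  -- 1`, which is at least `1 / s`.
  have hQ : ∏ i, (1 + s * o i) ≤ s * ∏ i, (1 + o i) := by
    have hw := one_add_sum_le_prod_one_add Finset.univ
      (z := fun i => (1 / s - 1) * (s * o i / (1 + s * o i))) fun i _ =>
        mul_nonneg (by rw [sub_nonneg, le_div_iff₀ hspos]; linarith)
          (div_nonneg (mul_nonneg hs0 (ho i)) (hpos s hs0 i).le)
    rw [← Finset.mul_sum, hsum] at hw
    have hprod : ∏ i, (1 + o i) = (∏ i, (1 + s * o i)) *
        ∏ i, (1 + (1 / s - 1) * (s * o i / (1 + s * o i))) := by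
      rw [← Finset.prod_mul_distrib]
      refine Finset.prod_congr rfl fun i _ => ?_
      rw [mul_add, mul_one, mul_left_comm, mul_div_cancel₀ _ (hpos s hs0 i).ne']
      field_simp
      ring
    have hP : 0 < ∏ i, (1 + s * o i) := Finset.prod_pos fun i _ => hpos s hs0 i
    have h1s : 1 ≤ s * ∏ i, (1 + (1 / s - 1) * (s * o i / (1 + s * o i))) := by
      have := mul_le_mul_of_nonneg_left hw hs0
      refine le_trans (le_of_eq ?_) this
      field_simp
      ring
    rw [hprod]
    nlinarith
  -- At a zero `t` the odds and their normalisation shrink by the same factor, so the solo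
  -- probabilities are unchanged. The function is `-1` at `0` and nonnegative at `s` by `hQ`.
  obtain ⟨t, ⟨ht0, hts⟩, ht⟩ := intermediate_value_Icc hs0
    (f := fun t : ℝ => t * ∏ i, (1 + o i) - ∏ i, (1 + t * o i)) (by fun_prop)
    (show (0 : ℝ) ∈ Set.Icc _ _ from ⟨by simp, by simpa using hQ⟩)
  simp only [sub_eq_zero] at ht
  have htpos : 0 < t := by
    refine lt_of_le_of_ne ht0 fun h => ?_
    rw [← h] at ht
    simp at ht
  refine ⟨fun i => t * o i / (1 + t * o i), fun i =>
    div_nonneg (mul_nonneg ht0 (ho i)) (hpos t ht0 i).le, fun i => ?_, ?_, ?_⟩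
  · refine (hmono t 1 ht0 (hts.trans hs1) i).trans (le_of_eq ?_)
    conv_rhs => rw [hx]
    simp
  · exact (Finset.sum_le_sum fun i _ => hmono t s ht0 hts i).trans hsum.le
  · ext i
    rw [soloProb_one_div_one_add (z := fun i => t * o i) fun i => mul_nonneg ht0 (ho i)]
    conv_rhs => rw [hx, soloProb_one_div_one_add ho]
    rw [← ht]
    exact mul_div_mul_left _ _ htpos.ne'

end Odds

/-! ### Extremal values of the probability of exactly one success -/

section SoloSum

variable {ι : Type*} [DecidableEq ι]

/-- The probability of exactly one success among the independent trials in `s`. -/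
noncomputable def soloSum (s : Finset ι) (x : ι → ℝ) : ℝ :=
  ∑ i ∈ s, x i * ∏ j ∈ s.erase i, (1 - x j)

theorem soloSum_congr {s : Finset ι} {x y : ι → ℝ} (h : ∀ i ∈ s, x i = y i) :
    soloSum s x = soloSum s y :=
  Finset.sum_congr rfl fun i hi => by
    rw [h i hi, Finset.prod_congr rfl fun j hj => by rw [h j (Finset.mem_of_mem_erase hj)]]

theorem soloSum_insert {s : Finset ι} {i : ι} (hi : i ∉ s) (x : ι → ℝ) :
    soloSum (insert i s) x = x i * ∏ j ∈ s, (1 - x j) + (1 - x i) * soloSum s x := by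
  rw [soloSum, Finset.sum_insert hi, Finset.erase_insert hi, soloSum, Finset.mul_sum]
  congr 1
  refine Finset.sum_congr rfl fun j hj => ?_
  have hij : i ≠ j := fun h => hi (h ▸ hj)
  rw [Finset.erase_insert_of_ne hij,
    Finset.prod_insert fun h => hi (Finset.mem_of_mem_erase h)]
  ring

theorem soloSum_eq_prod_mul_sum_odds {s : Finset ι} {x : ι → ℝ} (h : ∀ i ∈ s, x i < 1) :
    soloSum s x = (∏ i ∈ s, (1 - x i)) * ∑ i ∈ s, x i / (1 - x i) := by
  rw [soloSum, Finset.mul_sum]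
  refine Finset.sum_congr rfl fun i hi => ?_
  have : 1 - x i ≠ 0 := by linarith [h i hi]
  rw [← Finset.mul_prod_erase _ _ hi]
  field_simp

theorem soloSum_const (s : Finset ι) (u : ℝ) :
    soloSum s (fun _ => u) = s.card * (u * (1 - u) ^ (s.card - 1)) := by
  rw [soloSum, Finset.sum_congr rfl fun i hi => by
    rw [Finset.prod_const, Finset.card_erase_of_mem hi], Finset.sum_const, nsmul_eq_mul]

variable [Fintype ι]

theorem soloSum_univ_eq_of_const_off {x : ι → ℝ} {i : ι} {u : ℝ} (h : ∀ j, j ≠ i → x j = u) :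
    soloSum Finset.univ x = x i * (1 - u) ^ (Fintype.card ι - 1) +
      (1 - x i) * ((Fintype.card ι - 1 : ℕ) * (u * (1 - u) ^ (Fintype.card ι - 2))) := by
  have hc : (Finset.univ.erase i).card = Fintype.card ι - 1 := by
    rw [Finset.card_erase_of_mem (Finset.mem_univ i), Finset.card_univ]
  have h' : ∀ j ∈ Finset.univ.erase i, x j = u := fun j hj => h j (Finset.ne_of_mem_erase hj)
  rw [← Finset.insert_erase (Finset.mem_univ i), soloSum_insert (Finset.notMem_erase i _),
    soloSum_congr h', soloSum_const, Finset.prod_congr rfl fun j hj => by rw [h' j hj],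
    Finset.prod_const, hc, Nat.sub_sub]

theorem soloSum_univ_pair {i j : ι} (hij : i ≠ j) (x : ι → ℝ) :
    soloSum Finset.univ x =
      (x i * (1 - x j) + x j * (1 - x i)) * ∏ k ∈ (Finset.univ.erase i).erase j, (1 - x k) +
        (1 - x i) * (1 - x j) * soloSum ((Finset.univ.erase i).erase j) x := by
  have hj : j ∈ Finset.univ.erase i := by simp [hij.symm]
  rw [← Finset.insert_erase (Finset.mem_univ i), soloSum_insert (Finset.notMem_erase i _),
    Finset.erase_insert (Finset.notMem_erase i _), ← Finset.insert_erase hj,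
    soloSum_insert (Finset.notMem_erase j _), Finset.prod_insert (Finset.notMem_erase j _),
    Finset.erase_insert (Finset.notMem_erase j _)]
  ring

theorem sum_univ_pair {i j : ι} (hij : i ≠ j) (x : ι → ℝ) :
    ∑ k, x k = x i + x j + ∑ k ∈ (Finset.univ.erase i).erase j, x k := by
  have hj : j ∈ Finset.univ.erase i := by simp [hij.symm]
  rw [← Finset.add_sum_erase _ _ (Finset.mem_univ i), ← Finset.add_sum_erase _ _ hj, add_assoc]

/-- Replace the coordinates `i` and `j` by `u` and `v`. -/
def updatePair (x : ι → ℝ) (i j : ι) (u v : ℝ) : ι → ℝ :=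
  Function.update (Function.update x i u) j v

omit [Fintype ι] in
theorem updatePair_left {i j : ι} (hij : i ≠ j) (x : ι → ℝ) (u v : ℝ) :
    updatePair x i j u v i = u := by simp [updatePair, hij]

omit [Fintype ι] in
theorem updatePair_right (i j : ι) (x : ι → ℝ) (u v : ℝ) :
    updatePair x i j u v j = v := by simp [updatePair]

omit [Fintype ι] in
theorem updatePair_of_ne {i j k : ι} (hi : k ≠ i) (hj : k ≠ j) (x : ι → ℝ) (u v : ℝ) :
    updatePair x i j u v k = x k := by simp [updatePair, hi, hj]

omit [Fintype ι] in
theorem updatePair_mem_Icc {i j : ι} (hij : i ≠ j) {x : ι → ℝ} {u v c d : ℝ}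
    (hx : ∀ k, c ≤ x k ∧ x k ≤ d) (hu : c ≤ u ∧ u ≤ d) (hv : c ≤ v ∧ v ≤ d) (k : ι) :
    c ≤ updatePair x i j u v k ∧ updatePair x i j u v k ≤ d := by
  by_cases hj : k = j
  · rw [hj, updatePair_right]; exact hv
  by_cases hi : k = i
  · rw [hi, updatePair_left hij]; exact hu
  rw [updatePair_of_ne hi hj]
  exact hx k

theorem sum_updatePair {i j : ι} (hij : i ≠ j) (x : ι → ℝ) {u v : ℝ} (huv : u + v = x i + x j) :
    ∑ k, updatePair x i j u v k = ∑ k, x k := by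
  rw [sum_univ_pair hij, sum_univ_pair hij, updatePair_left hij, updatePair_right, huv]
  congr 1
  refine Finset.sum_congr rfl fun k hk => ?_
  rw [Finset.mem_erase, Finset.mem_erase] at hk
  exact updatePair_of_ne hk.2.1 hk.1 x u v

/-- At fixed `x i + x j` the value is affine in the product of the two coordinates. The sign of the
slope decides whether averaging or spreading the pair increases it. -/
theorem soloSum_updatePair {i j : ι} (hij : i ≠ j) (x : ι → ℝ) {u v : ℝ}
    (huv : u + v = x i + x j) :
    soloSum Finset.univ (updatePair x i j u v) = soloSum Finset.univ x + (u * v - x i * x j) *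
      (soloSum ((Finset.univ.erase i).erase j) x -
        2 * ∏ k ∈ (Finset.univ.erase i).erase j, (1 - x k)) := by
  have h : ∀ k ∈ (Finset.univ.erase i).erase j, updatePair x i j u v k = x k := fun k hk => by
    rw [Finset.mem_erase, Finset.mem_erase] at hk
    exact updatePair_of_ne hk.2.1 hk.1 x u v
  rw [soloSum_univ_pair hij, soloSum_univ_pair hij, updatePair_left hij, updatePair_right,
    soloSum_congr h, Finset.prod_congr rfl fun k hk => by rw [h k hk]]
  obtain rfl : v = x i + x j - u := by linarith
  ring

omit [Fintype ι] in
-- For `x i ≤ 1 / 2` the odds are at most `2 * x i`, so they sum to less than `2`. This makes the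
-- exchange slope negative.
theorem soloSum_lt_two_mul_prod {s : Finset ι} {x : ι → ℝ} (h0 : ∀ i ∈ s, 0 ≤ x i)
    (h1 : ∀ i ∈ s, x i ≤ 1 / 2) (hs : ∑ i ∈ s, x i < 1) :
    soloSum s x < 2 * ∏ i ∈ s, (1 - x i) := by
  have hA : 0 < ∏ i ∈ s, (1 - x i) := Finset.prod_pos fun i hi => by linarith [h1 i hi]
  rw [soloSum_eq_prod_mul_sum_odds fun i hi => by linarith [h1 i hi], mul_comm]
  refine mul_lt_mul_of_pos_right ?_ hA
  refine lt_of_le_of_lt (Finset.sum_le_sum (g := fun i => 2 * x i) fun i hi => ?_) ?_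
  · have := h1 i hi
    rw [div_le_iff₀ (by linarith)]
    nlinarith [h0 i hi]
  · rw [← Finset.mul_sum]
    linarith

omit [Fintype ι] in
-- One coordinate with odds above `2` already makes the exchange slope positive.
theorem two_mul_prod_lt_soloSum {s : Finset ι} {x : ι → ℝ} (h0 : ∀ i ∈ s, 0 ≤ x i)
    (h1 : ∀ i ∈ s, x i < 1) {i : ι} (hi : i ∈ s) (ho : 2 < x i / (1 - x i)) :
    2 * ∏ i ∈ s, (1 - x i) < soloSum s x := by
  have hA : 0 < ∏ i ∈ s, (1 - x i) := Finset.prod_pos fun i hi => by linarith [h1 i hi]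
  rw [soloSum_eq_prod_mul_sum_odds h1, mul_comm]
  refine mul_lt_mul_of_pos_left (ho.trans_le ?_) hA
  exact Finset.single_le_sum (f := fun i => x i / (1 - x i))
    (fun k hk => div_nonneg (h0 k hk) (by linarith [h1 k hk])) hi

omit [DecidableEq ι] in
theorem isCompact_box_sum_le (a c : ℝ) :
    IsCompact {x : ι → ℝ | (∀ i, 0 ≤ x i ∧ x i ≤ a) ∧ ∑ i, x i ≤ c} := by
  have h : {x : ι → ℝ | (∀ i, 0 ≤ x i ∧ x i ≤ a) ∧ ∑ i, x i ≤ c} =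
      (Set.univ.pi fun _ => Set.Icc 0 a) ∩ {x | ∑ i, x i ≤ c} := by
    ext x
    simp only [Set.mem_ofPred_eq, Set.mem_inter_iff, Set.mem_univ_pi, Set.mem_Icc]
  rw [h]
  exact (isCompact_univ_pi fun _ => isCompact_Icc).inter_right
    (isClosed_le (by fun_prop) continuous_const)

omit [Fintype ι] in
theorem continuous_soloSum (s : Finset ι) : Continuous (soloSum s) := by
  unfold soloSum
  fun_prop

theorem sum_rest_lt_one {x : ι → ℝ} (h0 : ∀ i, 0 ≤ x i) (hs : ∑ i, x i ≤ 1) {i j : ι}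
    (hij : i ≠ j) (hi : 0 < x i) : ∑ k ∈ (Finset.univ.erase i).erase j, x k < 1 := by
  have := sum_univ_pair hij x
  linarith [h0 j]

theorem add_le_one_of_sum_le_one {x : ι → ℝ} (h0 : ∀ i, 0 ≤ x i) (hs : ∑ i, x i ≤ 1) {i j : ι}
    (hij : i ≠ j) : x i + x j ≤ 1 := by
  have := sum_univ_pair hij x
  have : 0 ≤ ∑ k ∈ (Finset.univ.erase i).erase j, x k := Finset.sum_nonneg fun k _ => h0 k
  linarith

/-- Among points with the same sum at most one, the uniform one minimises the probability of
exactly one success. -/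
theorem sum_mul_le_soloSum [Nonempty ι] {x : ι → ℝ} (hx0 : ∀ i, 0 ≤ x i) (hx : ∑ i, x i ≤ 1) :
    (∑ i, x i) * (1 - 1 / (Fintype.card ι : ℝ)) ^ (Fintype.card ι - 1) ≤
      soloSum Finset.univ x := by
  set γ : ℝ := (1 - 1 / (Fintype.card ι : ℝ)) ^ (Fintype.card ι - 1)
  set K := {x : ι → ℝ | (∀ i, 0 ≤ x i ∧ x i ≤ 1) ∧ ∑ i, x i ≤ 1}
  have hxK : x ∈ K := ⟨fun i => ⟨hx0 i,
    (Finset.single_le_sum (fun j _ => hx0 j) (Finset.mem_univ i)).trans hx⟩, hx⟩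
  obtain ⟨y, ⟨hy01, hys⟩, hymin⟩ := (isCompact_box_sum_le (ι := ι) 1 1).exists_isMinOn ⟨x, hxK⟩
    (f := fun x => soloSum Finset.univ x - (∑ i, x i) * γ)
    ((continuous_soloSum _).sub (by fun_prop)).continuousOn
  have hxy := hymin hxK
  simp only [Set.mem_ofPred_eq] at hxy
  suffices h : 0 ≤ soloSum Finset.univ y - (∑ i, y i) * γ by linarith
  obtain ⟨i, hi⟩ := Finite.exists_max y
  -- Averaging a maximal coordinate with a smaller one would strictly lower the value: every
  -- remaining coordinate is at most `y i` and sums with it to at most `1`, hence is at most `1 /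
  -- 2`, and the slope is negative.
  have hconst : ∀ j, y j = y i := by
    by_contra! hne
    obtain ⟨j, hj⟩ := hne
    have hij : i ≠ j := fun h => hj (by rw [h])
    have hlt : y j < y i := lt_of_le_of_ne (hi j) hj
    have hadd := add_le_one_of_sum_le_one (fun k => (hy01 k).1) hys hij
    have huv : (y i + y j) / 2 + (y i + y j) / 2 = y i + y j := by ring
    have hmem : 0 ≤ (y i + y j) / 2 ∧ (y i + y j) / 2 ≤ 1 := by
      have := (hy01 i).1
      have := (hy01 j).1
      constructor <;> linarith
    have hm := hymin (show updatePair y i j ((y i + y j) / 2) ((y i + y j) / 2) ∈ K from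
      ⟨updatePair_mem_Icc hij hy01 hmem hmem, (sum_updatePair hij y huv).trans_le hys⟩)
    simp only [Set.mem_ofPred_eq, sum_updatePair hij y huv, soloSum_updatePair hij y huv] at hm
    have hlt2 := soloSum_lt_two_mul_prod (s := (Finset.univ.erase i).erase j) (x := y)
      (fun k _ => (hy01 k).1) (fun k hk => by
        rw [Finset.mem_erase, Finset.mem_erase] at hk
        have := add_le_one_of_sum_le_one (fun k => (hy01 k).1) hys hk.2.1
        linarith [hi k])
      (sum_rest_lt_one (fun k => (hy01 k).1) hys hij ((hy01 j).1.trans_lt hlt))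
    have h3 : 0 < (y i + y j) / 2 * ((y i + y j) / 2) - y i * y j := by
      nlinarith [mul_pos (sub_pos.2 hlt) (sub_pos.2 hlt)]
    nlinarith [mul_pos h3 (sub_pos.2 hlt2)]
  have hy : y = fun _ => y i := funext hconst
  have hn : (0 : ℝ) < Fintype.card ι := by exact_mod_cast Fintype.card_pos
  have hsum : ∑ k, y k = Fintype.card ι * y i := by
    rw [hy]
    simp
  have hu : y i ≤ 1 / Fintype.card ι := by
    rw [le_div_iff₀ hn]
    linarith
  have hY : soloSum Finset.univ y =
      Fintype.card ι * (y i * (1 - y i) ^ (Fintype.card ι - 1)) := by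
    conv_lhs => rw [hy, soloSum_const, Finset.card_univ]
  have hn1 : 1 / (Fintype.card ι : ℝ) ≤ 1 := by
    rw [div_le_one hn]
    exact_mod_cast Fintype.card_pos
  have hpow : γ ≤ (1 - y i) ^ (Fintype.card ι - 1) :=
    pow_le_pow_left₀ (by linarith) (by linarith) _
  rw [hY, hsum]
  have := mul_le_mul_of_nonneg_left hpow (mul_nonneg hn.le (hy01 i).1)
  linarith

end SoloSum

/-! ### A one-variable chord inequality -/

section Chord

theorem mul_pow_mul_sub_le_pow_sub_pow {v w : ℝ} (hv : 0 ≤ v) (hvw : v ≤ w) (hw : w ≤ 1) (k : ℕ) :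
    k * v ^ k * (w - v) ≤ w ^ k - v ^ k := by
  induction k with
  | zero => simp
  | succ k ih =>
    have h1 : w ^ (k + 1) - v ^ (k + 1) = w * (w ^ k - v ^ k) + v ^ k * (w - v) := by ring
    have h2 : 0 ≤ v ^ k * (w - v) := mul_nonneg (pow_nonneg hv k) (sub_nonneg.2 hvw)
    have h3 := mul_le_mul_of_nonneg_left ih (hv.trans hvw)
    have h4 := mul_le_mul_of_nonneg_right hvw (mul_nonneg (Nat.cast_nonneg (α := ℝ) k) h2)
    have h5 := mul_le_mul_of_nonneg_right (hvw.trans hw) h2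
    rw [h1, pow_succ]
    push_cast
    nlinarith

/-- This gives the monotonicity of secant slopes behind the chord bound; the induction step absorbs
the new term through the mean value estimate above. -/
theorem half_mul_pow_sub_pow_le_sum {v w : ℝ} (hv : 0 ≤ v) (hvw : v ≤ w) (hw : w ≤ 1) (k : ℕ) :
    ((k : ℝ) - 1) / 2 * (w ^ k - v ^ k) ≤ ∑ i ∈ Finset.range k, (w ^ i - v ^ i) := by
  induction k with
  | zero => simp
  | succ k ih =>
    rw [Finset.sum_range_succ]
    have h1 : w ^ (k + 1) - v ^ (k + 1) = w * (w ^ k - v ^ k) + v ^ k * (w - v) := by ring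
    have h2 := mul_pow_mul_sub_le_pow_sub_pow hv hvw hw k
    have h3 : 0 ≤ w ^ k - v ^ k := sub_nonneg.2 (pow_le_pow_left₀ hv hvw k)
    have h4 := mul_nonneg (mul_nonneg (Nat.cast_nonneg (α := ℝ) k) h3) (sub_nonneg.2 hw)
    rw [h1]
    push_cast
    nlinarith

/-- The function `u ↦ (1 - u) ^ k * (1 + c * u)` lies below its chord from `0` to `U`. -/
theorem mul_pow_mul_le_chord {c u U : ℝ} {k : ℕ} (hc : c ≤ ((k : ℝ) - 1) / 2) (hu : 0 ≤ u)
    (huU : u ≤ U) (hU : U ≤ 1) :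
    U * ((1 - u) ^ k * (1 + c * u)) ≤ U - (1 - (1 - U) ^ k * (1 + c * U)) * u := by
  -- The bracket is minus the slope of the secant from `0` to `t`; the chord bound says that it is
  -- no smaller at `u` than at `U`.
  have key : ∀ t : ℝ, (1 - t) ^ k * (1 + c * t) =
      1 - t * (∑ i ∈ Finset.range k, (1 - t) ^ i - c * (1 - t) ^ k) := fun t => by
    have := mul_neg_geom_sum (1 - t) k
    linear_combination this
  have h := half_mul_pow_sub_pow_le_sum (sub_nonneg.2 hU) (sub_le_sub_left huU 1)
    (by linarith) k
  rw [Finset.sum_sub_distrib] at h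
  have h0 : 0 ≤ (1 - u) ^ k - (1 - U) ^ k :=
    sub_nonneg.2 (pow_le_pow_left₀ (by linarith) (by linarith) k)
  have h2 := (mul_le_mul_of_nonneg_right hc h0).trans h
  rw [key u, key U]
  nlinarith [mul_le_mul_of_nonneg_left h2 (mul_nonneg hu (hu.trans huU))]

end Chord

/-! ### The constants `Ψ` and `Γ` -/

/-- `Ψ` is the endpoint value, at `U = 1 / ((1 + b) * (k + 1))`, of the function in the chord bound
with `c = (k + 1) / b - 1`. -/
theorem csmaPsi_eq {b : ℝ} (hb : 0 < b) (k : ℕ) :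
    csmaPsi b (k + 2) = (1 - 1 / ((1 + b) * (k + 1))) ^ k *
      (1 + ((k + 1) / b - 1) * (1 / ((1 + b) * (k + 1)))) := by
  have hk : (k : ℝ) + 1 ≠ 0 := by positivity
  have hb1 : 1 + b ≠ 0 := by positivity
  have hc : ((k + 2 : ℕ) : ℝ) - 1 = k + 1 := by push_cast; ring
  have h1 : (b * (k + 2 : ℕ) + (k + 2 : ℕ) - b - 2) / ((1 + b) * ((k : ℝ) + 1)) =
      1 - 1 / ((1 + b) * (k + 1)) := by
    push_cast
    field_simp
    ring
  have h2 : (((k : ℝ) + 1) * (1 + b) ^ 2 - (k + 2 : ℕ) * b) / (b * (1 + b) * ((k : ℝ) + 1)) =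
      1 + ((k + 1) / b - 1) * (1 / ((1 + b) * (k + 1))) := by
    push_cast
    field_simp
    ring
  rw [csmaPsi, hc, h1, h2, Nat.add_sub_cancel, mul_comm]

theorem one_div_one_add_mul_le_one {b : ℝ} (hb : 0 < b) (k : ℕ) :
    1 / ((1 + b) * ((k : ℝ) + 1)) ≤ 1 := by
  have hk : (0 : ℝ) ≤ k := Nat.cast_nonneg k
  rw [div_le_one (by positivity)]
  nlinarith [mul_nonneg hb.le hk]

theorem csmaPsi_le_one {b : ℝ} (hb : 2 < b) {n : ℕ} (hn : 1 < n) : csmaPsi b n ≤ 1 := by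
  obtain ⟨k, rfl⟩ : ∃ k, n = k + 2 := ⟨n - 2, by omega⟩
  have hk : (0 : ℝ) ≤ k := Nat.cast_nonneg k
  rw [csmaPsi_eq (by linarith) k]
  have hU1 := one_div_one_add_mul_le_one (show 0 < b by linarith) k
  have hU0 : 0 ≤ 1 / ((1 + b) * ((k : ℝ) + 1)) := by positivity
  set U := 1 / ((1 + b) * ((k : ℝ) + 1))
  have hc : ((k : ℝ) + 1) / b - 1 ≤ k := by
    have : ((k : ℝ) + 1) / b ≤ k + 1 := div_le_self (by positivity) (by linarith)
    linarith
  -- Bernoulli's inequality bounds `Ψ` by `((1 - U) * (1 + U)) ^ k`.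
  have h1 : 1 + (((k : ℝ) + 1) / b - 1) * U ≤ (1 + U) ^ k := by
    refine le_trans ?_ (one_add_mul_le_pow (by linarith) k)
    linarith [mul_le_mul_of_nonneg_right hc hU0]
  refine (mul_le_mul_of_nonneg_left h1 (pow_nonneg (sub_nonneg.2 hU1) k)).trans ?_
  rw [← mul_pow]
  exact pow_le_one₀ (by nlinarith) (by nlinarith)

theorem csmaPsi_nonneg {b : ℝ} (hb : 2 < b) {n : ℕ} (hn : 1 < n) : 0 ≤ csmaPsi b n := by
  obtain ⟨k, rfl⟩ : ∃ k, n = k + 2 := ⟨n - 2, by omega⟩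
  have hk : (0 : ℝ) ≤ k := Nat.cast_nonneg k
  rw [csmaPsi_eq (by linarith) k]
  have hU1 := one_div_one_add_mul_le_one (show 0 < b by linarith) k
  have hU0 : 0 ≤ 1 / ((1 + b) * ((k : ℝ) + 1)) := by positivity
  have hc : 0 ≤ ((k : ℝ) + 1) / b := by positivity
  refine mul_nonneg (pow_nonneg (sub_nonneg.2 hU1) k) ?_
  nlinarith [mul_nonneg hc hU0]

theorem csmaGamma_nonneg {b : ℝ} (hb : 0 < b) {n : ℕ} (hn : 1 ≤ n) : 0 ≤ csmaGamma b n := by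
  have h : 1 / (n : ℝ) ≤ 1 := by
    rw [div_le_one (by exact_mod_cast hn)]
    exact_mod_cast hn
  exact mul_nonneg (by positivity) (pow_nonneg (sub_nonneg.2 h) _)

/-- The value of the probability of exactly one success at a point with one saturated
coordinate. -/
theorem soloSum_saturated {b : ℝ} (hb : 0 < b) {n k : ℕ} (hn : n = k + 2) {x : Fin n → ℝ}
    {i : Fin n} {u : ℝ} (hi : x i = b / (1 + b)) (h : ∀ j, j ≠ i → x j = u) :
    soloSum Finset.univ x =
      b / (1 + b) * ((1 - u) ^ k * (1 + ((k + 1) / b - 1) * u)) := by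
  subst hn
  rw [soloSum_univ_eq_of_const_off h, hi, Fintype.card_fin, Nat.add_sub_cancel,
    show k + 2 - 1 = k + 1 from rfl, pow_succ]
  push_cast
  field_simp
  ring

/-- The sharp affine upper bound for the probability of exactly one success in terms of the
expected number of successes. -/
theorem soloSum_add_mul_sum_le {b : ℝ} (hb : 2 < b) {n : ℕ} (hn : 1 < n) {x : Fin n → ℝ}
    (hx : ∀ i, 0 ≤ x i ∧ x i ≤ b / (1 + b)) (hs : ∑ i, x i ≤ 1) :
    soloSum Finset.univ x + b * (1 - csmaPsi b n) * ∑ i, x i ≤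
      b / (1 + b) * (1 + b * (1 - csmaPsi b n)) := by
  have hψ := csmaPsi_le_one hb hn
  set a := b / (1 + b) with ha
  set l := b * (1 - csmaPsi b n) with hl
  have hl0 : 0 ≤ l := mul_nonneg (by linarith) (by linarith)
  have ha0 : 0 < a := by positivity
  have ha1 : a < 1 := (div_lt_one (by linarith)).2 (by linarith)
  set K := {x : Fin n → ℝ | (∀ i, 0 ≤ x i ∧ x i ≤ a) ∧ ∑ i, x i ≤ 1}
  obtain ⟨y, ⟨hya, hys⟩, hymax⟩ := (isCompact_box_sum_le (ι := Fin n) a 1).exists_isMaxOn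
    ⟨x, hx, hs⟩ (f := fun x => soloSum Finset.univ x + l * ∑ i, x i)
    ((continuous_soloSum _).add (by fun_prop)).continuousOn
  have hxy := hymax (show x ∈ K from ⟨hx, hs⟩)
  simp only [Set.mem_ofPred_eq] at hxy
  refine hxy.trans ?_
  -- First-order condition at the maximiser: no admissible exchange at fixed sum gains anything.
  have hexch : ∀ i j, i ≠ j → ∀ u v, u + v = y i + y j → 0 ≤ u ∧ u ≤ a → 0 ≤ v ∧ v ≤ a →
      (u * v - y i * y j) * (soloSum ((Finset.univ.erase i).erase j) y -
        2 * ∏ k ∈ (Finset.univ.erase i).erase j, (1 - y k)) ≤ 0 := by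
    intro i j hij u v huv hu hv
    have hm := hymax (show updatePair y i j u v ∈ K from
      ⟨updatePair_mem_Icc hij hya hu hv, (sum_updatePair hij y huv).trans_le hys⟩)
    simp only [Set.mem_ofPred_eq, sum_updatePair hij y huv, soloSum_updatePair hij y huv] at hm
    linarith
  by_cases hsat : ∃ i, y i = a
  · obtain ⟨i, hi⟩ := hsat
    have hconst : ∀ j k, j ≠ i → k ≠ i → y j = y k := by
      intro j k hj hk
      by_contra hne
      have hjk : j ≠ k := fun h => hne (by rw [h])
      have hmem : 0 ≤ (y j + y k) / 2 ∧ (y j + y k) / 2 ≤ a := by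
        have := hya j
        have := hya k
        constructor <;> linarith
      have h1 := hexch j k hjk _ _ (by ring) hmem hmem
      -- The odds of a saturated coordinate are exactly `b`. With `b > 2`, averaging any two unequal
      -- other coordinates would be a gain.
      have hodds : 2 < y i / (1 - y i) := by
        rw [hi, lt_div_iff₀ (by linarith)]
        have : a * (1 + b) = b := by rw [ha]; field_simp
        nlinarith
      have h2 := two_mul_prod_lt_soloSum (s := (Finset.univ.erase j).erase k) (x := y)
        (fun l _ => (hya l).1) (fun l _ => (hya l).2.trans_lt ha1)
        (i := i) (by simp [hj.symm, hk.symm]) hodds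
      have h3 : 0 < (y j + y k) / 2 * ((y j + y k) / 2) - y j * y k := by
        have : 0 < (y j - y k) ^ 2 := by
          have := sub_ne_zero.2 hne
          positivity
        nlinarith
      nlinarith [mul_pos h3 (sub_pos.2 h2)]
    obtain ⟨k, hk⟩ : ∃ k, n = k + 2 := ⟨n - 2, by omega⟩
    have : Nontrivial (Fin n) := Fin.nontrivial_iff_two_le.2 hn
    obtain ⟨j, hj⟩ := exists_ne i
    have hoff : ∀ l, l ≠ i → y l = y j := fun l hl => hconst l j hl hj
    have hk0 : (0 : ℝ) ≤ k := Nat.cast_nonneg k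
    have hsum : ∑ l, y l = a + (k + 1) * y j := by
      rw [← Finset.add_sum_erase _ _ (Finset.mem_univ i), hi,
        Finset.sum_congr rfl fun l hl => hoff l (Finset.ne_of_mem_erase hl), Finset.sum_const,
        Finset.card_erase_of_mem (Finset.mem_univ i), Finset.card_univ, Fintype.card_fin, hk,
        nsmul_eq_mul, show k + 2 - 1 = k + 1 from rfl]
      push_cast
      ring
    have hY := soloSum_saturated (by linarith) hk hi hoff
    rw [← ha] at hY
    have hU1 := one_div_one_add_mul_le_one (show 0 < b by linarith) k
    -- The other `k + 1` coordinates share at most `1 - a = 1 / (1 + b)`.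
    have huU : y j ≤ 1 / ((1 + b) * ((k : ℝ) + 1)) := by
      rw [le_div_iff₀ (by positivity)]
      have h1 : (1 - a) * (1 + b) = 1 := by rw [ha]; field_simp; ring
      have h2 : (k + 1) * y j ≤ 1 - a := by linarith
      nlinarith
    -- The condition `c ≤ (k - 1) / 2` is where `b ≥ 2` enters a second time.
    have hchord := mul_pow_mul_le_chord (c := (k + 1) / b - 1) (k := k) (by
      have : ((k : ℝ) + 1) / b ≤ (k + 1) / 2 :=
        div_le_div_of_nonneg_left (by positivity) (by norm_num) hb.le
      linarith) (hya j).1 huU hU1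
    have hΨ := csmaPsi_eq (show 0 < b by linarith) k
    rw [← hk] at hΨ
    rw [← hΨ] at hchord
    rw [hY, hsum]
    set f := (1 - y j) ^ k * (1 + ((k + 1) / b - 1) * y j)
    have hf : f ≤ 1 - (1 - csmaPsi b n) * y j * ((1 + b) * (k + 1)) := by
      have hpos : 0 < (1 + b) * ((k : ℝ) + 1) := by positivity
      have := mul_le_mul_of_nonneg_left hchord hpos.le
      have e : (1 + b) * ((k : ℝ) + 1) * (1 / ((1 + b) * (k + 1))) = 1 := by field_simp
      have e1 : (1 + b) * ((k : ℝ) + 1) * (1 / ((1 + b) * (k + 1)) * f) = f := by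
        rw [← mul_assoc, e, one_mul]
      rw [e1, mul_sub, e] at this
      linarith
    have h1 := mul_le_mul_of_nonneg_left hf ha0.le
    have h2 : a * ((1 - csmaPsi b n) * y j * ((1 + b) * (k + 1))) = l * ((k + 1) * y j) := by
      rw [hl, ha]
      field_simp
    rw [mul_sub, h2] at h1
    linarith
  · push Not at hsat
    have hlt : ∀ i, y i < a := fun i => lt_of_le_of_ne (hya i).2 (hsat i)
    have : Nontrivial (Fin n) := Fin.nontrivial_iff_two_le.2 hn
    -- Without saturation, the two largest coordinates `i` and `j` can be pushed apart. All others
    -- are at most `y j ≤ 1 / 2`, so the slope is negative and this is a gain unless `y j = 0`.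
    obtain ⟨i, hi⟩ := Finite.exists_max y
    obtain ⟨j₀, hj₀⟩ := exists_ne i
    obtain ⟨j, hjmem, hj⟩ := Finset.exists_max_image (Finset.univ.erase i) y
      ⟨j₀, by simp [hj₀]⟩
    have hij : i ≠ j := (Finset.ne_of_mem_erase hjmem).symm
    obtain hj0 | hjpos := (hya j).1.eq_or_lt
    · have hzero : ∀ k, k ≠ i → y k = 0 := fun k hk =>
        le_antisymm (hj0 ▸ hj k (by simp [hk])) (hya k).1
      have hsum : ∑ k, y k = y i := Finset.sum_eq_single i (fun k _ hk => hzero k hk) (by simp)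
      rw [soloSum_univ_eq_of_const_off hzero, hsum]
      simp only [sub_zero, one_pow, mul_zero, add_zero, mul_one]
      nlinarith [(hlt i).le]
    · exfalso
      have hadd := add_le_one_of_sum_le_one (fun k => (hya k).1) hys hij
      have hsumlt := sum_rest_lt_one (fun k => (hya k).1) hys hij (hjpos.trans_le (hi j))
      have h2 := soloSum_lt_two_mul_prod (s := (Finset.univ.erase i).erase j) (x := y)
        (fun k _ => (hya k).1) (fun k hk => by
          have := hj k (Finset.mem_of_mem_erase hk)
          linarith [hi j]) hsumlt
      set δ := min (a - y i) (y j) with hδ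
      have hδ0 : 0 < δ := lt_min (sub_pos.2 (hlt i)) hjpos
      have hδ1 : δ ≤ a - y i := min_le_left _ _
      have hδ2 : δ ≤ y j := min_le_right _ _
      have h1 := hexch i j hij (y i + δ) (y j - δ) (by ring)
        ⟨by linarith [(hya i).1], by linarith⟩ ⟨by linarith, by linarith [(hya j).2]⟩
      have h3 : (y i + δ) * (y j - δ) - y i * y j < 0 := by
        nlinarith [hi j, mul_pos hδ0 hδ0, mul_nonneg hδ0.le (sub_nonneg.2 (hi j))]
      nlinarith [mul_pos_of_neg_of_neg h3 (sub_neg.2 h2)]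

/-! ### Bounds for the total power -/

/-- The bound `1 - κ` amounts to `κ * (1 + m * G) ≤ 1 - β * s`, which is affine in `(s, G)`; `h1`
and `h2` are this inequality at `(1, 1)` and `((b + 1) / b, Ψ)`. -/
theorem div_le_of_chord {β m G s κ B Ψ b : ℝ} (hb : 0 < b) (hm : 0 < m) (hβ0 : 0 ≤ β) (hG : 0 ≤ G)
    (hGs : G ≤ s) (hs : s ≤ (b + 1) / b) (hchord : G + b * (1 - Ψ) * s ≤ 1 + b * (1 - Ψ))
    (hκ : 0 ≤ κ) (hB : B = 1 - κ) (h1 : κ * (1 + m) ≤ 1 - β)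
    (h2 : κ * (1 + m * Ψ) ≤ 1 - β * ((b + 1) / b)) : (β * s + m * G) / (1 + m * G) ≤ B := by
  have hmG : 0 ≤ m * G := mul_nonneg hm.le hG
  rw [div_le_iff₀ (by linarith), hB]
  suffices h : κ * (1 + m * G) ≤ 1 - β * s by linarith
  obtain hs1 | hs1 := le_total s 1
  · have e1 : κ * (1 + m * G) ≤ κ * (1 + m) :=
      mul_le_mul_of_nonneg_left (by nlinarith) hκ
    nlinarith [mul_le_mul_of_nonneg_left hs1 hβ0]
  · have hw0 : 0 ≤ b * (s - 1) := mul_nonneg hb.le (by linarith)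
    have hw1 : b * (s - 1) ≤ 1 := by
      rw [le_div_iff₀ hb] at hs
      linarith
    have e1 : κ * (1 + m * G) ≤ κ * (1 + m * (1 + b * (1 - Ψ) - b * (1 - Ψ) * s)) :=
      mul_le_mul_of_nonneg_left (by nlinarith) hκ
    have e2 := mul_le_mul_of_nonneg_left h1 (sub_nonneg.2 hw1)
    have e3 := mul_le_mul_of_nonneg_left h2 hw0
    have e4 : b * (s - 1) * (1 - β * ((b + 1) / b)) = (s - 1) * (b - β * (b + 1)) := by
      field_simp
    rw [e4] at e3
    nlinarith

theorem div_le_of_mul_le {β m G s k Γ : ℝ} (hm : 0 < m) (hβ0 : 0 ≤ β) (hk : 0 < k) (hG : 0 ≤ G)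
    (hs : s ≤ k) (hΓ : 0 ≤ Γ) (hβ : 1 ≤ β * k) (hlow : s * Γ ≤ k * G) :
    (β * s + m * G) / (1 + m * G) ≤ (m * Γ + β * k) / (m * Γ + 1) := by
  have hmG : 0 ≤ m * G := mul_nonneg hm.le hG
  have hmΓ : 0 ≤ m * Γ := mul_nonneg hm.le hΓ
  rw [div_le_div_iff₀ (by linarith) (by linarith)]
  have e1 := mul_le_mul_of_nonneg_left hlow (mul_nonneg hm.le (sub_nonneg.2 hβ))
  have e2 := mul_nonneg (mul_nonneg hβ0 hk.le) (sub_nonneg.2 hs)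
  have e3 := mul_nonneg hmΓ (sub_nonneg.2 hs)
  refine le_of_mul_le_mul_left ?_ hk
  nlinarith

/-! ### Transfer of the bounds to the network -/

namespace CSMANetwork

variable {n : ℕ} (N : CSMANetwork n)

theorem lossFactor_mul_sum_soloProb (p : Fin n → ℝ) :
    N.lossFactor * ∑ i, soloProb N.lossFactor p i =
      soloSum Finset.univ fun j => N.lossFactor * p j := by
  rw [Finset.mul_sum, soloSum]
  exact Finset.sum_congr rfl fun i _ => by rw [mul_soloProb, soloProb]; simp only [one_mul]

theorem lossFactor_mul_inv : N.lossFactor * ((N.captureRatio + 1) / N.captureRatio) = 1 := by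
  have := N.one_lt_captureRatio
  have h1 : N.captureRatio ≠ 0 := by linarith
  have h2 : 1 + N.captureRatio ≠ 0 := by linarith
  rw [lossFactor]
  field_simp
  ring

theorem sum_lossFactor_mul_le_one {p : Fin n → ℝ}
    (h : ∑ i, p i ≤ (N.captureRatio + 1) / N.captureRatio) :
    ∑ i, N.lossFactor * p i ≤ 1 := by
  rw [← Finset.mul_sum, ← N.lossFactor_mul_inv]
  exact mul_le_mul_of_nonneg_left h N.lossFactor_pos.le

theorem sum_soloProb_add_le (hb : 2 < N.captureRatio) (hn : 1 < n) (p : Fin n → unitInterval)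
    (h : ∑ i, (p i : ℝ) ≤ (N.captureRatio + 1) / N.captureRatio) :
    ∑ i, soloProb N.lossFactor (fun j => (p j : ℝ)) i +
      N.captureRatio * (1 - csmaPsi N.captureRatio n) * ∑ i, (p i : ℝ) ≤
      1 + N.captureRatio * (1 - csmaPsi N.captureRatio n) := by
  have ha := N.lossFactor_pos
  have key := soloSum_add_mul_sum_le hb hn (x := fun j => N.lossFactor * p j)
    (fun i => ⟨mul_nonneg ha.le (p i).2.1, mul_le_of_le_one_right ha.le (p i).2.2⟩)
    (N.sum_lossFactor_mul_le_one h)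
  rw [← lossFactor_mul_sum_soloProb, ← Finset.mul_sum] at key
  refine le_of_mul_le_mul_left ?_ ha
  change _ ≤ N.lossFactor * _ at key
  linarith

theorem sum_mul_csmaGamma_le (hn : 1 ≤ n) (p : Fin n → unitInterval)
    (h : ∑ i, (p i : ℝ) ≤ (N.captureRatio + 1) / N.captureRatio) :
    (∑ i, (p i : ℝ)) * csmaGamma N.captureRatio n ≤ (N.captureRatio + 1) / N.captureRatio *
      ∑ i, soloProb N.lossFactor (fun j => (p j : ℝ)) i := by
  have ha := N.lossFactor_pos
  have : Nonempty (Fin n) := ⟨⟨0, hn⟩⟩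
  have key := sum_mul_le_soloSum (x := fun j => N.lossFactor * (p j : ℝ))
    (fun i => mul_nonneg ha.le (p i).2.1) (N.sum_lossFactor_mul_le_one h)
  rw [← lossFactor_mul_sum_soloProb, ← Finset.mul_sum, Fintype.card_fin, mul_assoc] at key
  have := le_of_mul_le_mul_left key ha
  have hb := N.one_lt_captureRatio
  have hk : 0 ≤ (N.captureRatio + 1) / N.captureRatio := by positivity
  have := mul_le_mul_of_nonneg_left this hk
  rw [csmaGamma]
  linarith

section Common

variable {N} {M m : ℝ} (hT : ∀ i, N.dataTime i = M * N.handshakeTime)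
  (hm : m = M * Real.exp (-N.captureRatio * (N.noise / N.power)))

include hT hm

/-- The witness is the throughput of `p` itself, so tightness only requires checking the sum of the
request probabilities. -/
theorem mem_feasibleRegion_and_isBetterNash (hm0 : 0 < m) {p : Fin n → unitInterval}
    (h : ∑ i, (p i : ℝ) ≤ (N.captureRatio + 1) / N.captureRatio) :
    ∃ ρ ∈ N.feasibleRegion, N.IsBetterNash ρ p := by
  have hp := (isNash_iff hT hm hm0 (throughput_nonneg hT hm hm0 p) p).2 rfl
  exact ⟨N.throughput p, ⟨throughput_nonneg hT hm hm0 p, p, hp⟩, hp, h⟩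

theorem existsUnique_isBetterNash (hm0 : 0 < m) {ρ : Fin n → ℝ} (hρ : ρ ∈ N.feasibleRegion) :
    ∃! p, N.IsBetterNash ρ p := by
  obtain ⟨hρ0, q, hq⟩ := hρ
  rw [isNash_iff hT hm hm0 hρ0] at hq
  have ha := N.lossFactor_pos
  have hx0 : ∀ (p : Fin n → unitInterval) i, 0 ≤ N.lossFactor * (p i : ℝ) :=
    fun p i => mul_nonneg ha.le (p i).2.1
  have hx1 : ∀ (p : Fin n → unitInterval) i, N.lossFactor * (p i : ℝ) < 1 :=
    fun p i => N.lossFactor_mul_lt_one (p i)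
  have hsolo : ∀ p p' : Fin n → unitInterval, N.throughput p = N.throughput p' ↔
      soloProb 1 (fun j => N.lossFactor * (p j : ℝ)) =
        soloProb 1 (fun j => N.lossFactor * (p' j : ℝ)) := by
    intro p p'
    rw [throughput_eq_iff hT hm hm0, funext_iff, funext_iff]
    refine forall_congr' fun i => ?_
    rw [← mul_soloProb, ← mul_soloProb, mul_right_inj' ha.ne']
  obtain ⟨y, hy0, hyq, hys, hy⟩ := exists_soloProb_one_eq_sum_le_one (hx0 q) (hx1 q)
  -- Contraction keeps `y i ≤ a * q i`, so `y i / a` is still a probability.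
  let p : Fin n → unitInterval := fun i => ⟨y i / N.lossFactor, div_nonneg (hy0 i) ha.le,
    ((div_le_iff₀ ha).2 (by linarith [hyq i])).trans (q i).2.2⟩
  have hpy : ∀ i, N.lossFactor * (p i : ℝ) = y i := fun i => mul_div_cancel₀ _ ha.ne'
  refine ⟨p, ⟨?_, ?_⟩, ?_⟩
  · rw [isNash_iff hT hm hm0 hρ0, ← hq, hsolo]
    simp only [hpy]
    exact hy
  · refine le_of_mul_le_mul_left ?_ ha
    rw [N.lossFactor_mul_inv, Finset.mul_sum]
    simp only [hpy]
    exact hys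
  · rintro p' ⟨hp', hs'⟩
    rw [isNash_iff hT hm hm0 hρ0, ← hq, hsolo] at hp'
    have := eq_of_soloProb_one_eq (hx0 p') (hx1 p') (N.sum_lossFactor_mul_le_one hs') hy0
      (fun i => (hyq i).trans_lt (hx1 q i)) hys (hp'.trans hy.symm)
    ext i
    refine mul_left_cancel₀ ha.ne' ?_
    rw [hpy]
    exact congrFun this i

theorem totalPower_eq_of_sum_eq {p : Fin n → unitInterval} {s G : ℝ} (hs : ∑ i, (p i : ℝ) = s)
    (hG : soloSum Finset.univ (fun j => N.lossFactor * (p j : ℝ)) = N.lossFactor * G) :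
    N.totalPower p = (m * G + N.rtsFraction * s) / (m * G + 1) := by
  rw [← lossFactor_mul_sum_soloProb] at hG
  rw [totalPower_eq hT hm, hs, mul_left_cancel₀ N.lossFactor_pos.ne' hG, add_comm (m * G),
    add_comm (m * G)]

end Common

end CSMANetwork

/-! ### Assembly of the bounds and the extremal points -/

theorem sum_eq_of_const_off {n : ℕ} {x : Fin n → ℝ} {i : Fin n} {u : ℝ}
    (h : ∀ j, j ≠ i → x j = u) : ∑ j, x j = x i + ((n : ℝ) - 1) * u := by
  have hn : 1 ≤ n := i.pos
  rw [← Finset.add_sum_erase _ _ (Finset.mem_univ i),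
    Finset.sum_congr rfl fun l hl => h l (Finset.ne_of_mem_erase hl), Finset.sum_const,
    Finset.card_erase_of_mem (Finset.mem_univ i), Finset.card_univ, Fintype.card_fin,
    nsmul_eq_mul, Nat.cast_sub hn, Nat.cast_one]

theorem theorem2 (n : ℕ) (hn : 1 ≤ n) (N : CSMANetwork n) (b M M' β : ℝ)
    (hNb : N.captureRatio = b) (hb : 2 < b)
    (hT : ∀ i, N.dataTime i = M * N.handshakeTime)
    (hcode : ∀ i j, N.successRate i = N.successRate j)
    (hM' : M' = M * Real.exp (-b * (N.noise / N.power)))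
    (hβ : β = N.rtsFraction) :
    -- the upper bounds at the better Nash equilibrium of any feasible demands
    (∀ ρ ∈ N.feasibleRegion,
      (∃! p, N.IsBetterNash ρ p) ∧
      ∀ p, N.IsBetterNash ρ p →
        (n = 1 → N.totalPower p ≤ (M' + β) / (M' + 1)) ∧
        (1 < n →
          (β ≤ M' * b * (1 - csmaPsi b n) / (1 + M' + M' * b * (1 - csmaPsi b n)) →
            N.totalPower p ≤ (M' + β) / (M' + 1)) ∧
          (M' * b * (1 - csmaPsi b n) / (1 + M' + M' * b * (1 - csmaPsi b n)) ≤ β →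
            β ≤ b / (b + 1) →
            N.totalPower p ≤
              (M' * csmaPsi b n + β * ((b + 1) / b)) / (M' * csmaPsi b n + 1)) ∧
          (b / (b + 1) ≤ β →
            N.totalPower p ≤
              (M' * csmaGamma b n + β * ((b + 1) / b)) / (M' * csmaGamma b n + 1)))) ∧
    -- attained at `(1, 0, …, 0)` and its permutations
    (∀ i₀ : Fin n, ∃ p : Fin n → unitInterval,
      (p i₀ : ℝ) = 1 ∧ (∀ j, j ≠ i₀ → (p j : ℝ) = 0) ∧
      (∃ ρ ∈ N.feasibleRegion, N.IsBetterNash ρ p) ∧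
      N.totalPower p = (M' + β) / (M' + 1)) ∧
    -- attained at `(1, 1 / ((n - 1) b), …, 1 / ((n - 1) b))` and its permutations
    (1 < n → ∀ i₀ : Fin n, ∃ p : Fin n → unitInterval,
      (p i₀ : ℝ) = 1 ∧ (∀ j, j ≠ i₀ → (p j : ℝ) = 1 / (((n : ℝ) - 1) * b)) ∧
      (∃ ρ ∈ N.feasibleRegion, N.IsBetterNash ρ p) ∧
      N.totalPower p = (M' * csmaPsi b n + β * ((b + 1) / b)) / (M' * csmaPsi b n + 1)) ∧
    -- attained at the uniform point
    (1 < n → ∃ p : Fin n → unitInterval,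
      (∀ i, (p i : ℝ) = (b + 1) / ((n : ℝ) * b)) ∧
      (∃ ρ ∈ N.feasibleRegion, N.IsBetterNash ρ p) ∧
      N.totalPower p = (M' * csmaGamma b n + β * ((b + 1) / b)) / (M' * csmaGamma b n + 1)) := by
  subst hNb hβ
  have hb0 : 0 < N.captureRatio := by linarith
  have ha := N.lossFactor_pos
  have hβ0 := N.rtsFraction_pos
  have hβ1 := N.rtsFraction_lt_one
  -- Positivity of `M` follows from the data period of a node, which exists as `1 ≤ n`.
  have hM0 : 0 < M := by
    have h0 : 0 < N.handshakeTime := N.rtsTime_pos.trans N.rtsTime_lt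
    have := N.dataTime_pos ⟨0, hn⟩
    rw [hT] at this
    exact pos_of_mul_pos_left this h0.le
  have hm0 : 0 < M' := hM' ▸ mul_pos hM0 (Real.exp_pos _)
  refine ⟨fun ρ hρ => ⟨CSMANetwork.existsUnique_isBetterNash hT hM' hm0 hρ, ?_⟩, ?_, ?_, ?_⟩
  · rintro p ⟨-, hp⟩
    have hG0 : 0 ≤ ∑ i, soloProb N.lossFactor (fun j => (p j : ℝ)) i :=
      Finset.sum_nonneg fun i _ => soloProb_nonneg (fun j => (p j).2.1)
        (fun j => (N.lossFactor_mul_lt_one (p j)).le) i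
    have hGs : ∑ i, soloProb N.lossFactor (fun j => (p j : ℝ)) i ≤ ∑ i, (p i : ℝ) :=
      Finset.sum_le_sum fun i _ => soloProb_le ha.le (fun j => (p j).2.1)
        (fun j => (N.lossFactor_mul_lt_one (p j)).le) i
    rw [CSMANetwork.totalPower_eq hT hM']
    have hκ1 : 0 ≤ (1 - N.rtsFraction) / (1 + M') := div_nonneg (by linarith) (by linarith)
    have hB1 : (M' + N.rtsFraction) / (M' + 1) = 1 - (1 - N.rtsFraction) / (1 + M') := by
      field_simp
      ring
    have h11 : (1 - N.rtsFraction) / (1 + M') * (1 + M') = 1 - N.rtsFraction :=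
      div_mul_cancel₀ _ (by linarith)
    refine ⟨fun hn1 => ?_, fun hn1 => ?_⟩
    · subst hn1
      simp only [Fin.sum_univ_one, Fin.isValue] at hG0 hGs ⊢
      have hp1 := (p 0).2.2
      set G := soloProb N.lossFactor (fun j => (p j : ℝ)) 0
      have hmG : 0 ≤ M' * G := mul_nonneg hm0.le hG0
      rw [hB1, div_le_iff₀ (by linarith)]
      have e1 := mul_le_mul_of_nonneg_left hp1 hβ0.le
      have e2 := mul_le_mul_of_nonneg_left (hGs.trans hp1) hm0.le
      have e3 := mul_le_mul_of_nonneg_left e2 hκ1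
      nlinarith
    · have hchord := N.sum_soloProb_add_le hb hn1 p hp
      have hΨ1 := csmaPsi_le_one hb hn1
      have hΨ0 := csmaPsi_nonneg hb hn1
      have hmΨ : 0 ≤ M' * csmaPsi N.captureRatio n := mul_nonneg hm0.le hΨ0
      have hden : 0 < 1 + M' + M' * N.captureRatio * (1 - csmaPsi N.captureRatio n) := by
        have := mul_nonneg (mul_nonneg hm0.le hb0.le) (sub_nonneg.2 hΨ1)
        linarith
      -- The sign of this expression compares the values of `κ` at the two vertices, and it changes
      -- exactly at the threshold for `β`.
      have hcross : N.captureRatio * ((1 - N.rtsFraction *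
          ((N.captureRatio + 1) / N.captureRatio)) * (1 + M') -
          (1 - N.rtsFraction) * (1 + M' * csmaPsi N.captureRatio n)) =
          M' * N.captureRatio * (1 - csmaPsi N.captureRatio n) - N.rtsFraction *
            (1 + M' + M' * N.captureRatio * (1 - csmaPsi N.captureRatio n)) := by
        field_simp
        ring
      refine ⟨fun h => ?_, fun h h' => ?_, fun h => ?_⟩
      · refine div_le_of_chord hb0 hm0 hβ0.le hG0 hGs hp hchord hκ1 hB1 h11.le ?_
        rw [le_div_iff₀ hden] at h
        rw [div_mul_eq_mul_div, div_le_iff₀ (by linarith)]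
        have := nonneg_of_mul_nonneg_right (hcross.symm ▸ sub_nonneg.2 h) hb0
        linarith
      · refine div_le_of_chord hb0 hm0 hβ0.le hG0 hGs hp hchord
          (κ := (1 - N.rtsFraction * ((N.captureRatio + 1) / N.captureRatio)) /
            (1 + M' * csmaPsi N.captureRatio n)) (div_nonneg ?_ (by linarith)) ?_ ?_ ?_
        · rw [le_div_iff₀ (by linarith)] at h'
          rw [← mul_div_assoc, sub_nonneg, div_le_one hb0]
          exact h'
        · rw [eq_sub_iff_add_eq, add_comm (M' * csmaPsi N.captureRatio n) 1, ← add_div,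
            div_eq_one_iff_eq (by linarith)]
          ring
        · rw [div_le_iff₀ hden] at h
          rw [div_mul_eq_mul_div, div_le_iff₀ (by linarith)]
          refine le_of_sub_nonpos (nonpos_of_mul_nonpos_right ?_ hb0)
          rw [hcross]
          linarith
        · exact (div_mul_cancel₀ _ (by linarith)).le
      · refine div_le_of_mul_le hm0 hβ0.le (by positivity) hG0 hp
          (csmaGamma_nonneg hb0 hn) ?_ (N.sum_mul_csmaGamma_le hn p hp)
        rw [div_le_iff₀ (by linarith)] at h
        rw [← mul_div_assoc, le_div_iff₀ hb0, one_mul]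
        exact h
  · intro i₀
    have hp0 : ∀ j, j ≠ i₀ → ((Function.update (fun _ => 0) i₀ 1 : Fin n → unitInterval) j : ℝ) = 0 :=
      fun j hj => by simp [hj]
    have hp1 : ((Function.update (fun _ => 0) i₀ 1 : Fin n → unitInterval) i₀ : ℝ) = 1 := by simp
    generalize (Function.update (fun _ => 0) i₀ 1 : Fin n → unitInterval) = p at hp0 hp1
    have hsum := sum_eq_of_const_off hp0
    rw [hp1, mul_zero, add_zero] at hsum
    refine ⟨p, hp1, hp0, CSMANetwork.mem_feasibleRegion_and_isBetterNash hT hM' hm0 ?_, ?_⟩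
    · rw [hsum, le_div_iff₀ hb0]
      linarith
    · rw [CSMANetwork.totalPower_eq_of_sum_eq hT hM' (G := 1) hsum, mul_one, mul_one]
      rw [soloSum_univ_eq_of_const_off (i := i₀) (u := 0) fun j hj => by rw [hp0 j hj, mul_zero],
        hp1]
      simp
  · intro hn1 i₀
    have hn1' : (0 : ℝ) < n - 1 := sub_pos.2 (by exact_mod_cast hn1)
    have hu1 : 1 / (((n : ℝ) - 1) * N.captureRatio) ≤ 1 := by
      have : (1 : ℝ) ≤ n - 1 := by
        have : (2 : ℝ) ≤ n := by exact_mod_cast hn1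
        linarith
      rw [div_le_one (by positivity)]
      nlinarith
    let v : unitInterval := ⟨1 / (((n : ℝ) - 1) * N.captureRatio), by positivity, hu1⟩
    have hp0 : ∀ j, j ≠ i₀ → ((Function.update (fun _ => v) i₀ 1 : Fin n → unitInterval) j : ℝ) =
        1 / (((n : ℝ) - 1) * N.captureRatio) := fun j hj => by simp [hj, v]
    have hp1 : ((Function.update (fun _ => v) i₀ 1 : Fin n → unitInterval) i₀ : ℝ) = 1 := by simp
    generalize (Function.update (fun _ => v) i₀ 1 : Fin n → unitInterval) = p at hp0 hp1
    have hsum : ∑ i, (p i : ℝ) = (N.captureRatio + 1) / N.captureRatio := by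
      rw [sum_eq_of_const_off hp0, hp1]
      field_simp
    refine ⟨p, hp1, hp0, CSMANetwork.mem_feasibleRegion_and_isBetterNash hT hM' hm0 hsum.le, ?_⟩
    refine CSMANetwork.totalPower_eq_of_sum_eq hT hM' hsum ?_
    obtain ⟨k, hk⟩ : ∃ k, n = k + 2 := ⟨n - 2, by omega⟩
    have hnk : (n : ℝ) - 1 = k + 1 := by rw [hk]; push_cast; ring
    have hΨ := csmaPsi_eq hb0 k
    rw [← hk] at hΨ
    rw [hΨ]
    refine soloSum_saturated hb0 hk (i := i₀) (by rw [hp1, mul_one]; rfl) fun j hj => ?_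
    rw [hp0 j hj, hnk, CSMANetwork.lossFactor]
    field_simp
  · intro hn1
    have hv1 : (N.captureRatio + 1) / ((n : ℝ) * N.captureRatio) ≤ 1 := by
      have : (2 : ℝ) ≤ n := by exact_mod_cast hn1
      rw [div_le_one (by positivity)]
      nlinarith
    have hsum : ∑ _i : Fin n, (N.captureRatio + 1) / ((n : ℝ) * N.captureRatio) =
        (N.captureRatio + 1) / N.captureRatio := by
      rw [Finset.sum_const, Finset.card_univ, Fintype.card_fin, nsmul_eq_mul]
      field_simp
    refine ⟨fun _ => ⟨_, by positivity, hv1⟩, fun _ => rfl,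
      CSMANetwork.mem_feasibleRegion_and_isBetterNash hT hM' hm0 hsum.le,
      CSMANetwork.totalPower_eq_of_sum_eq hT hM' hsum ?_⟩
    -- In the rescaled variables the extremal point is the uniform distribution, where the lower
    -- bound on the sum is attained.
    have e : N.lossFactor * ((N.captureRatio + 1) / ((n : ℝ) * N.captureRatio)) = 1 / n := by
      have := N.lossFactor_mul_inv
      rw [← div_div, div_right_comm, ← mul_div_assoc, this]
    simp only [e]
    rw [soloSum_const, Finset.card_univ, Fintype.card_fin, csmaGamma, ← mul_assoc, ← mul_assoc,
      N.lossFactor_mul_inv]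
    field_simp
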